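/- **Setting.** Let $x=(x_1,\dots,x_n)$ with blocks $x_i\in\mathbb R^{n_i}$, $n_x=\sum_i n_i$, let $z\in\mathbb R^{n_z}$, $n_c\ge 1$, and consider $$\min_{x,z}\ F(x)+\phi(z)\quad\text{s.t.}\quad A(x)+Qz=0,\qquad F(x)=f(x)+\sum_{i=1}^n I_i(x_i),$$ where $I_i$ is the indicator function ($0$ or $+\infty$) of a closed convex set $X_i\subseteq\mathbb R^{n_i}$; $f$ is $C^2$, $\mu_f$-strongly convex and $L_f$-smooth (its gradient is $L_f$-Lipschitz) with minimizer $x_f^\star$; $\phi$ is $C^2$, $\mu_\phi$-strongly convex and $L_\phi$-smooth with minimizer $z_\phi^\star$ ($\mu_f,L_f,\mu_\phi,L_\phi>0$); $Q\in\mathbb R^{n_c\times n_z}$ has full row rank; and $A:\mathbb R^{n_x}\to\mathbb R^{n_c}$, $A(x)_i=\tfrac12x^TC_ix+d_i^Tx+e_i$, is affine in each block $x_j$ when the other blocks are fixed. Let $\|C\|=\max_i\|C_i\|$ (spectral norms), $\|d\|=\max_i\|d_i\|$, $\|e\|=\max_i|e_i|$. Let $\lambda_{\min}$ and $\lambda^+_{\min}$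 denote the smallest and the smallest positive eigenvalue. Let $\rho>0$ with $$\rho\ge\max\Big\{\tfrac{4L_\phi^2}{\mu_\phi\lambda_{\min}^+(Q^TQ)},\tfrac{4L_\phi^2}{\mu_\phi\sqrt{\lambda_{\min}^+(QQ^T)}}\Big\},$$ $$L(x,z,w)=F(x)+\phi(z)+\langle w,A(x)+Qz\rangle+\tfrac\rho2\|A(x)+Qz\|^2 .$$ ADMM iterates are any sequence $(x^k,z^k,w^k)_{k\ge0}$ such that, for all $k\ge 0$, $x_i^{k+1}\in\arg\min_{x_i}L(x_{1:i-1}^{k+1},x_i,x_{i+1:n}^k,z^k,w^k)$ for $i=1,\dots,n$ in turn, $z^{k+1}\in\arg\min_zL(x^{k+1},z,w^k)$, and $w^{k+1}=w^k+\rho(A(x^{k+1})+Qz^{k+1})$. Assume $x_i^0\in X_i$ for all $i$. Put $$m_1=\frac{\mu_f\sqrt{\mu_\phi}}{\sqrt{n_c}\,L_\phi\big(\sqrt{L_f}(\|x_f^\star\|+\|x^0\|)+\sqrt{L_\phi}\|z_\phi^\star\|\big)},\quad m_2=\frac{\mu_f\sqrt{\mu_\phi}}{\sqrt{L_\phi^3n_c^2}\,(\|x^0\|\|d\|+\|e\|)},\quad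 m_3=\Big(\frac{\mu_f\sqrt{\mu_\phi}}{\sqrt{L_\phi^3n_c^2}\,\|x^0\|^2}\Big)^{1/2},$$ read as $+\infty$ when the denominator is $0$. **Theorem (linear convergence).** There is an absolute constant $\kappa>0$ such that the following holds for every problem and parameters as above. If the starting point satisfies $A(x^0)+Qz^0=0$ and $Q^Tw^0=-\nabla\phi(z^0)$, and $$\|C\|\le\kappa\,\|(QQ^T)^{-1}Q\|^{-1}\min\Big\{m_1,\ m_2\,\lambda_{\min}(QQ^T)^{1/2},\ m_3\,\lambda_{\min}(QQ^T)^{1/4}\|(QQ^T)^{-1}Q\|^{1/2}\Big\},$$ then the iterates have a limit point, and for every limit point $(x^\star,z^\star,w^\star)$ of the iterates at which $L$ is twice differentiable (in particular finite nearby): 1. the Hessian of $L$ at $(x^\star,z^\star,w^\star)$ is nondegenerate; 2. $(x^k,z^k,w^k)\to(x^\star,z^\star,w^\star)$, all values $L(x^k,z^k,w^k)$ are finite, and there is $c_1>1$ with $L(x^k,z^k,w^k)-L(x^\star,z^\star,w^\star)\in\mathcal O(c_1^{-k})$; 3. $(x^\star,z^\star)$ is feasible and is a local minimum of the constrained problem.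 Moreover, for arbitrary $z^0,w^0$ (and $x^0_i\in X_i$) there is $\delta>0$, depending on the starting point and on all the problem data and parameters except the matrices $C_i$, such that the same conclusions hold whenever $\|C\|\le\delta$. -/

import Mathlib

open Filter Topology
open scoped Matrix Matrix.Norms.L2Operator ENNReal

namespace MultiAffineADMM

/-- Column vectors `ℝ^m` with the Euclidean norm. -/
abbrev Vec (m : ℕ) : Type := EuclideanSpace ℝ (Fin m)

/-- `x = (x_1, …, x_n)` with blocks `x_i ∈ ℝ^{n_i}` (where `n_i = ν i`), with the Euclidean norm
of `ℝ^{n_1 + ⋯ + n_n}`. -/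
abbrev BlockVec {n : ℕ} (ν : Fin n → ℕ) : Type := PiLp 2 (fun i : Fin n => Vec (ν i))

/-- The scalar coordinates of a block vector: coordinate `j` of block `i`. -/
abbrev Coord {n : ℕ} (ν : Fin n → ℕ) : Type := Σ i : Fin n, Fin (ν i)

/-- The list of all scalar coordinates of a block vector. -/
def coords {n : ℕ} {ν : Fin n → ℕ} (x : BlockVec ν) : Coord ν → ℝ := fun s => x s.1 s.2

/-- `(u, x_{-i})`: the block vector `x` with its `i`-th block replaced by `u`. -/
def setBlock {n : ℕ} {ν : Fin n → ℕ} (x : BlockVec ν) (i : Fin n) (u : Vec (ν i)) : BlockVec ν :=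
  WithLp.toLp 2 (Function.update (fun j => x j) i u)

/-- `(y_1, …, y_i, x_{i+1}, …, x_n)`. -/
def sweep {n : ℕ} {ν : Fin n → ℕ} (y x : BlockVec ν) (i : Fin n) : BlockVec ν :=
  WithLp.toLp 2 (fun j => if j ≤ i then y j else x j)

/-- The data of the problem `min f(x) + ∑ I_i(x_i) + φ(z)` subject to `A(x) + Q z = 0`, except for
the matrices `C_i` of the quadratic part of `A`. -/
structure Data (n : ℕ) (ν : Fin n → ℕ) (nc nz : ℕ) where
  f : BlockVec ν → ℝ
  X : (i : Fin n) → Set (Vec (ν i))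
  φ : Vec nz → ℝ
  Q : Matrix (Fin nc) (Fin nz) ℝ
  d : Fin nc → BlockVec ν
  e : Fin nc → ℝ

/-- The matrices `C_1, …, C_{n_c}`. -/
abbrev QuadPart {n : ℕ} (ν : Fin n → ℕ) (nc : ℕ) : Type :=
  Fin nc → Matrix (Coord ν) (Coord ν) ℝ

section Problem

variable {n : ℕ} {ν : Fin n → ℕ} {nc nz : ℕ}

/-- `A(x)_i = xᵀ C_i x / 2 + d_iᵀ x + e_i`. -/
noncomputable def constraintMap (P : Data n ν nc nz) (C : QuadPart ν nc) (x : BlockVec ν) :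
    Vec nc :=
  WithLp.toLp 2 (fun i =>
    (coords x ⬝ᵥ (C i *ᵥ coords x)) / 2 + inner ℝ (P.d i) x + P.e i)

/-- `A` is a multi-affine quadratic operator: it is affine in each block when the other blocks are
fixed. -/
def IsMultiAffine (P : Data n ν nc nz) (C : QuadPart ν nc) : Prop :=
  ∀ (j : Fin n) (x : BlockVec ν), ∃ g : Vec (ν j) →ᵃ[ℝ] Vec nc,
    ∀ u : Vec (ν j), constraintMap P C (setBlock x j u) = g u

/-- `A(x) + Q z`. -/
noncomputable def residual (P : Data n ν nc nz) (C : QuadPart ν nc)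
    (x : BlockVec ν) (z : Vec nz) : Vec nc :=
  constraintMap P C x + Matrix.toEuclideanLin P.Q z

open Classical in
/-- The (extended-valued) indicator function of a set. -/
noncomputable def indicatorFn {α : Type*} (S : Set α) (u : α) : EReal := if u ∈ S then 0 else ⊤

/-- `F(x) = f(x) + ∑ I_i(x_i)`. -/
noncomputable def objF (P : Data n ν nc nz) (x : BlockVec ν) : EReal :=
  (P.f x : EReal) + ∑ i : Fin n, indicatorFn (P.X i) (x i)

/-- The augmented Lagrangian
`L(x, z, w) = F(x) + φ(z) + ⟨w, A(x) + Q z⟩ + (ρ / 2) ‖A(x) + Q z‖²`. -/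
noncomputable def lagrangian (P : Data n ν nc nz) (C : QuadPart ν nc) (ρ : ℝ)
    (p : BlockVec ν × Vec nz × Vec nc) : EReal :=
  objF P p.1 + ((P.φ p.2.1 + inner ℝ p.2.2 (residual P C p.1 p.2.1)
    + ρ / 2 * ‖residual P C p.1 p.2.1‖ ^ 2 : ℝ) : EReal)

/-- `(x^k, z^k, w^k)` is a sequence of iterates of ADMM with penalty parameter `ρ`. -/
structure IsADMM (P : Data n ν nc nz) (C : QuadPart ν nc) (ρ : ℝ)
    (x : ℕ → BlockVec ν) (z : ℕ → Vec nz) (w : ℕ → Vec nc) : Prop where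
  x_step : ∀ (k : ℕ) (i : Fin n) (u : Vec (ν i)),
    lagrangian P C ρ (sweep (x (k + 1)) (x k) i, z k, w k) ≤
      lagrangian P C ρ (setBlock (sweep (x (k + 1)) (x k) i) i u, z k, w k)
  z_step : ∀ (k : ℕ) (u : Vec nz),
    lagrangian P C ρ (x (k + 1), z (k + 1), w k) ≤ lagrangian P C ρ (x (k + 1), u, w k)
  w_step : ∀ k : ℕ, w (k + 1) = w k + ρ • residual P C (x (k + 1)) (z (k + 1))

/-- `g` is `L`-smooth: its gradient is `L`-Lipschitz, with `L > 0`. -/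
def IsSmoothWith {E : Type*} [NormedAddCommGroup E] [InnerProductSpace ℝ E] [CompleteSpace E]
    (L : ℝ) (g : E → ℝ) : Prop :=
  0 < L ∧ ∀ u v : E, ‖gradient g u - gradient g v‖ ≤ L * ‖u - v‖

/-- The smallest eigenvalue of a symmetric matrix. -/
noncomputable def lamMin {m : ℕ} (B : Matrix (Fin m) (Fin m) ℝ) : ℝ := sInf (spectrum ℝ B)

/-- The smallest positive eigenvalue of a symmetric matrix. -/
noncomputable def lamMinPos {m : ℕ} (B : Matrix (Fin m) (Fin m) ℝ) : ℝ :=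
  sInf {t : ℝ | t ∈ spectrum ℝ B ∧ 0 < t}

/-- The standing assumptions on the objective, on `Q` and on the penalty parameter. -/
structure Assumptions (P : Data n ν nc nz) (μf Lf μφ Lφ ρ : ℝ)
    (xf : BlockVec ν) (zφ : Vec nz) : Prop where
  X_closed : ∀ i, IsClosed (P.X i)
  X_convex : ∀ i, Convex ℝ (P.X i)
  f_C2 : ContDiff ℝ 2 P.f
  μf_pos : 0 < μf
  f_strong : StrongConvexOn Set.univ μf P.f
  f_smooth : IsSmoothWith Lf P.f
  f_min : IsMinOn P.f Set.univ xf
  φ_C2 : ContDiff ℝ 2 P.φ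
  μφ_pos : 0 < μφ
  φ_strong : StrongConvexOn Set.univ μφ P.φ
  φ_smooth : IsSmoothWith Lφ P.φ
  φ_min : IsMinOn P.φ Set.univ zφ
  Q_rank : P.Q.rank = nc
  ρ_pos : 0 < ρ
  ρ_ge : max (4 * Lφ ^ 2 / (μφ * lamMinPos (P.Qᵀ * P.Q)))
    (4 * Lφ ^ 2 / (μφ * √(lamMinPos (P.Q * P.Qᵀ)))) ≤ ρ

/-- `‖C‖ = max_i ‖C_i‖` (spectral norms). -/
noncomputable def normC (C : QuadPart ν nc) : ℝ := ⨆ i, ‖C i‖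

/-- `‖d‖ = max_i ‖d_i‖`. -/
noncomputable def normd (P : Data n ν nc nz) : ℝ := ⨆ i, ‖P.d i‖

/-- `‖e‖ = max_i |e_i|`. -/
noncomputable def norme (P : Data n ν nc nz) : ℝ := ⨆ i, |P.e i|

/-- `m₁`; equal to `∞` when its denominator vanishes. -/
noncomputable def m₁ (nc : ℕ) (μf Lf μφ Lφ : ℝ) (xf : BlockVec ν) (zφ : Vec nz)
    (x0 : BlockVec ν) : ℝ≥0∞ :=
  ENNReal.ofReal (μf * √μφ) /
    ENNReal.ofReal (√nc * Lφ * (√Lf * (‖xf‖ + ‖x0‖) + √Lφ * ‖zφ‖))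

/-- `m₂`; equal to `∞` when its denominator vanishes. -/
noncomputable def m₂ (P : Data n ν nc nz) (μf μφ Lφ : ℝ) (x0 : BlockVec ν) : ℝ≥0∞ :=
  ENNReal.ofReal (μf * √μφ) /
    ENNReal.ofReal (√(Lφ ^ 3 * (nc : ℝ) ^ 2) * (‖x0‖ * normd P + norme P))

/-- `m₃`; equal to `∞` when its denominator vanishes. -/
noncomputable def m₃ (nc : ℕ) (μf μφ Lφ : ℝ) (x0 : BlockVec ν) : ℝ≥0∞ :=
  (ENNReal.ofReal (μf * √μφ) /
    ENNReal.ofReal (√(Lφ ^ 3 * (nc : ℝ) ^ 2) * ‖x0‖ ^ 2)) ^ (1 / 2 : ℝ)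

/-- The condition `‖C‖ ≤ κ ‖(Q Qᵀ)⁻¹ Q‖⁻¹ ·
min {m₁, m₂ λ_min(Q Qᵀ)^{1/2}, m₃ λ_min(Q Qᵀ)^{1/4} ‖(Q Qᵀ)⁻¹ Q‖^{1/2}}`. -/
def QCondition (κ : ℝ) (P : Data n ν nc nz) (C : QuadPart ν nc) (μf Lf μφ Lφ : ℝ)
    (xf : BlockVec ν) (zφ : Vec nz) (x0 : BlockVec ν) : Prop :=
  ENNReal.ofReal (normC C) ≤
    ENNReal.ofReal (κ * ‖(P.Q * P.Qᵀ)⁻¹ * P.Q‖⁻¹) *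
      min (m₁ nc μf Lf μφ Lφ xf zφ x0)
        (min (m₂ P μf μφ Lφ x0 * ENNReal.ofReal (lamMin (P.Q * P.Qᵀ) ^ (1 / 2 : ℝ)))
          (m₃ nc μf μφ Lφ x0 * ENNReal.ofReal (lamMin (P.Q * P.Qᵀ) ^ (1 / 4 : ℝ) *
            ‖(P.Q * P.Qᵀ)⁻¹ * P.Q‖ ^ (1 / 2 : ℝ))))

/-- An extended-real-valued function is twice differentiable at `p`: it is finite and differentiable
near `p`, and its derivative is differentiable at `p`. -/
def TwiceDifferentiableAt {E : Type*} [NormedAddCommGroup E] [NormedSpace ℝ E]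
    (g : E → EReal) (p : E) : Prop :=
  (∀ᶠ q in 𝓝 p, g q ≠ ⊤ ∧ g q ≠ ⊥) ∧
  (∀ᶠ q in 𝓝 p, DifferentiableAt ℝ (fun q' => (g q').toReal) q) ∧
  DifferentiableAt ℝ (fderiv ℝ (fun q' => (g q').toReal)) p

/-- The Hessian of `g` at `p` is nondegenerate (as a symmetric bilinear form). -/
def HessianNondegenerate {E : Type*} [NormedAddCommGroup E] [NormedSpace ℝ E]
    (g : E → EReal) (p : E) : Prop :=
  ∀ u : E, (∀ v : E, fderiv ℝ (fderiv ℝ (fun q' => (g q').toReal)) p u v = 0) → u = 0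

/-- `(xs, zs)` is feasible, and a local minimum of `F(x) + φ(z)` subject to `A(x) + Q z = 0`. -/
def IsLocalSolution (P : Data n ν nc nz) (C : QuadPart ν nc)
    (xs : BlockVec ν) (zs : Vec nz) : Prop :=
  residual P C xs zs = 0 ∧
  IsLocalMinOn (fun q : BlockVec ν × Vec nz => objF P q.1 + (P.φ q.2 : EReal))
    {q | residual P C q.1 q.2 = 0} (xs, zs)

/-- The iterates have a limit point; and at every limit point at which `L` is twice differentiable,
the Hessian of `L` is nondegenerate, the iterates converge to that point,
`L(x^k, z^k, w^k) - L(x*, z*, w*) = O(c₁^{-k})` for some `c₁ > 1`, and `(x*, z*)` is a local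
minimum of the problem. -/
def LinearConvergence (P : Data n ν nc nz) (C : QuadPart ν nc) (ρ : ℝ)
    (x : ℕ → BlockVec ν) (z : ℕ → Vec nz) (w : ℕ → Vec nc) : Prop :=
  (∃ p : BlockVec ν × Vec nz × Vec nc, MapClusterPt p atTop (fun k => (x k, z k, w k))) ∧
  ∀ (xs : BlockVec ν) (zs : Vec nz) (ws : Vec nc),
    MapClusterPt (xs, zs, ws) atTop (fun k => (x k, z k, w k)) →
    TwiceDifferentiableAt (lagrangian P C ρ) (xs, zs, ws) →
      HessianNondegenerate (lagrangian P C ρ) (xs, zs, ws) ∧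
      Tendsto (fun k => (x k, z k, w k)) atTop (𝓝 (xs, zs, ws)) ∧
      (∀ k, lagrangian P C ρ (x k, z k, w k) ≠ ⊤ ∧ lagrangian P C ρ (x k, z k, w k) ≠ ⊥) ∧
      (∃ c₁ : ℝ, 1 < c₁ ∧
        (fun k => (lagrangian P C ρ (x k, z k, w k)).toReal
          - (lagrangian P C ρ (xs, zs, ws)).toReal) =O[atTop] fun k : ℕ => (c₁ ^ k)⁻¹) ∧
      IsLocalSolution P C xs zs

end Problem

end MultiAffineADMM

namespace MultiAffineADMM

/-! ### Convexity inequalities and an abstract linear convergence criterion -/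

section Analysis

variable {E : Type*} [NormedAddCommGroup E] [NormedSpace ℝ E]

/-! Although the problem is nonconvex, each ADMM subproblem is strongly convex, because the
constraint is affine in each block; so every primal update lowers the Lagrangian by a multiple of
its squared length. Optimality in `z` gives `Qᵀ w = -∇φ(z)` after every iteration, so a dual step is
bounded by the slack step, and for large `ρ` the increase it causes is at most half of the slack
decrease (`IsADMM.descent`). Moving `z` to a slack value that makes `x` feasible shows that the
Lagrangian is bounded below (`lagR_lower`). Hence steps tend to zero and the iterates are eventually
bounded.

Where the Lagrangian is twice differentiable it is finite nearby, so the indicators vanish there and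
the function is smooth. Its gradient at a new iterate is bounded by the last step
(`IsADMM.norm_fderiv_le`), so the limit point is stationary. The only curvature that can spoil
strong convexity on the tangent space of the constraint is `⟨w, C(a, a)⟩`, of size `√n_c ‖C‖ ‖w‖
‖a‖²`. If this is below `μ_f ‖a‖²`, the Hessian is nondegenerate (`hessian_lagR_nondegenerate`) and
the point solves the problem (`isLocalSolution_of_kkt`). A nondegenerate Hessian makes the distance
to the limit at most a multiple of the gradient, hence of the last step; together with descent this
yields a geometric rate (`linear_convergence_of_error_bound`).

What remains is to bound `‖w‖` at the limit. Dual consistency reduces this to `‖z - z_φ‖`, which is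
controlled by the Lagrangian gap at the start; the thresholds on `‖C‖` make the resulting product
smaller than `μ_f`. -/

lemma growth_of_strongConvexOn {s : Set E} {m : ℝ} {f : E → ℝ} (hf : StrongConvexOn s m f)
    {x y : E} (hx : x ∈ s) (hy : y ∈ s) (hmin : ∀ u ∈ s, f x ≤ f u) :
    f x + m / 2 * ‖y - x‖ ^ 2 ≤ f y := by
  have key : ∀ t : ℝ, 0 < t → t < 1 → (1 - t) * (m / 2 * ‖y - x‖ ^ 2) ≤ f y - f x := by
    intro t h0 h1
    have h := hf.2 hx hy (by linarith : (0 : ℝ) ≤ 1 - t) h0.le (by ring)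
    have h2 := hmin _ (hf.1 hx hy (by linarith : (0 : ℝ) ≤ 1 - t) h0.le (by ring))
    simp only [smul_eq_mul] at h
    rw [norm_sub_rev] at h
    have h3 : 0 ≤ t * (f y - f x - (1 - t) * (m / 2 * ‖y - x‖ ^ 2)) := by nlinarith
    have := nonneg_of_mul_nonneg_right h3 h0
    linarith
  by_contra hcon
  have hD := hmin y hy
  set c := m / 2 * ‖y - x‖ ^ 2
  have hc : 0 < c := by linarith
  -- With this `t`, `(1 - t) * c` is the midpoint of `c` and `f y - f x`, which exceeds `f y - f x`.
  have h1 := key ((c - (f y - f x)) / (2 * c)) (by apply div_pos <;> linarith)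
    (by rw [div_lt_one (by linarith)]; linarith)
  have : (1 - (c - (f y - f x)) / (2 * c)) * c = (c + (f y - f x)) / 2 := by
    field_simp; ring
  linarith

lemma hasDerivAt_line {F : Type*} [NormedAddCommGroup F] [NormedSpace ℝ F] {f : E → F}
    (hf : Differentiable ℝ f) (x v : E) (t : ℝ) :
    HasDerivAt (fun t : ℝ => f (x + t • v)) (fderiv ℝ f (x + t • v) v) t := by
  have h1 : HasDerivAt (fun t : ℝ => x + t • v) v t := by
    simpa using ((hasDerivAt_id t).smul_const v).const_add x
  exact (hf (x + t • v)).hasFDerivAt.comp_hasDerivAt t h1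

/-- Divide the strong convexity inequality on the segment by `t` and let `t` decrease to zero. -/
lemma strongConvex_lower {m : ℝ} {f : E → ℝ} (hf : StrongConvexOn Set.univ m f)
    (hd : Differentiable ℝ f) (x y : E) :
    f x + fderiv ℝ f x (y - x) + m / 2 * ‖y - x‖ ^ 2 ≤ f y := by
  have h0 := hasDerivAt_line hd x (y - x) 0
  simp only [zero_smul, add_zero] at h0
  have ht := h0.tendsto_slope_zero_right
  have ht2 : Tendsto (fun t : ℝ => f y - f x - (1 - t) * (m / 2 * ‖y - x‖ ^ 2)) (𝓝[>] 0)
      (𝓝 (f y - f x - (1 - 0) * (m / 2 * ‖y - x‖ ^ 2))) :=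
    (Continuous.tendsto (by fun_prop) 0).mono_left nhdsWithin_le_nhds
  have hev : ∀ᶠ t : ℝ in 𝓝[>] 0, t⁻¹ • (f (x + (0 + t) • (y - x)) - f (x + (0 : ℝ) • (y - x)))
      ≤ f y - f x - (1 - t) * (m / 2 * ‖y - x‖ ^ 2) := by
    filter_upwards [Ioo_mem_nhdsGT (zero_lt_one' ℝ)] with t ⟨h0, h1⟩
    have h := hf.2 (Set.mem_univ x) (Set.mem_univ y) (by linarith : (0 : ℝ) ≤ 1 - t) h0.le (by ring)
    simp only [smul_eq_mul] at h
    rw [norm_sub_rev] at h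
    have he : (1 - t) • x + t • y = x + (0 + t) • (y - x) := by module
    rw [he] at h
    rw [smul_eq_mul, inv_mul_le_iff₀ h0, zero_smul, add_zero]
    nlinarith
  have := le_of_tendsto_of_tendsto ht ht2 hev
  linarith

lemma strongConvex_monotone {m : ℝ} {f : E → ℝ} (hf : StrongConvexOn Set.univ m f)
    (hd : Differentiable ℝ f) (x y : E) :
    m * ‖y - x‖ ^ 2 ≤ (fderiv ℝ f y - fderiv ℝ f x) (y - x) := by
  have h1 := strongConvex_lower hf hd x y
  have h2 := strongConvex_lower hf hd y x
  have h3 : fderiv ℝ f y (x - y) = - fderiv ℝ f y (y - x) := by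
    rw [← map_neg, neg_sub]
  rw [norm_sub_rev, h3] at h2
  simp only [sub_apply]
  linarith

lemma smooth_upper {L : ℝ} {f : E → ℝ} (hd : Differentiable ℝ f)
    (hL : ∀ u v, ‖fderiv ℝ f u - fderiv ℝ f v‖ ≤ L * ‖u - v‖) (x y : E) :
    f y ≤ f x + fderiv ℝ f x (y - x) + L / 2 * ‖y - x‖ ^ 2 := by
  set v := y - x with hv
  have hder : ∀ t : ℝ, HasDerivAt
      (fun t : ℝ => f (x + t • v) - t * fderiv ℝ f x v - t ^ 2 * (L / 2 * ‖v‖ ^ 2))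
      (fderiv ℝ f (x + t • v) v - fderiv ℝ f x v - 2 * t * (L / 2 * ‖v‖ ^ 2)) t := by
    intro t
    have h1 := hasDerivAt_line hd x v t
    have h2 := (hasDerivAt_id t).mul_const (fderiv ℝ f x v)
    have h3 := (hasDerivAt_pow 2 t).mul_const (L / 2 * ‖v‖ ^ 2)
    exact ((h1.sub h2).sub h3).congr_deriv (by norm_num)
  have hanti : AntitoneOn
      (fun t : ℝ => f (x + t • v) - t * fderiv ℝ f x v - t ^ 2 * (L / 2 * ‖v‖ ^ 2))
      (Set.Icc 0 1) := by
    apply antitoneOn_of_deriv_nonpos (convex_Icc 0 1)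
    · exact fun t _ => (hder t).continuousAt.continuousWithinAt
    · exact fun t _ => (hder t).differentiableAt.differentiableWithinAt
    · intro t ht
      rw [interior_Icc] at ht
      rw [(hder t).deriv]
      have h1 := (fderiv ℝ f (x + t • v) - fderiv ℝ f x).le_opNorm v
      have h2 := hL (x + t • v) x
      rw [add_sub_cancel_left, norm_smul, Real.norm_of_nonneg ht.1.le] at h2
      have h3 := le_abs_self ((fderiv ℝ f (x + t • v) - fderiv ℝ f x) v)
      rw [← Real.norm_eq_abs] at h3
      simp only [sub_apply] at h1 h3
      have h4 := mul_le_mul_of_nonneg_right h2 (norm_nonneg v)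
      nlinarith
  have := hanti (Set.left_mem_Icc.2 zero_le_one) (Set.right_mem_Icc.2 zero_le_one) zero_le_one
  simp only [one_smul, zero_smul, add_zero] at this
  rw [hv, add_sub_cancel, ← hv] at this
  linarith

lemma hessian_lower {m : ℝ} {f : E → ℝ} (hf : StrongConvexOn Set.univ m f)
    (hd : ContDiff ℝ 2 f) (x a : E) :
    m * ‖a‖ ^ 2 ≤ fderiv ℝ (fderiv ℝ f) x a a := by
  have hd1 : Differentiable ℝ f := hd.differentiable (by norm_num)
  have hd2 : Differentiable ℝ (fderiv ℝ f) :=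
    (hd.fderiv_right (m := 1) (by norm_num)).differentiable (by norm_num)
  have h0 := (hasDerivAt_line hd2 x a 0).clm_apply (hasDerivAt_const 0 a)
  simp only [zero_smul, add_zero, map_zero] at h0
  have ht := h0.tendsto_slope_zero_right
  refine ge_of_tendsto ht ?_
  filter_upwards [self_mem_nhdsWithin] with t (h0 : 0 < t)
  have h := strongConvex_monotone hf hd1 x (x + t • a)
  rw [add_sub_cancel_left, norm_smul, Real.norm_of_nonneg h0.le, map_smul] at h
  simp only [sub_apply, smul_eq_mul] at h
  simp only [zero_add, zero_smul, add_zero, smul_eq_mul]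
  rw [le_inv_mul_iff₀ h0]
  have h2 : 0 ≤ t * ((fderiv ℝ f (x + t • a) a - fderiv ℝ f x a) - t * (m * ‖a‖ ^ 2)) := by
    nlinarith
  have := nonneg_of_mul_nonneg_right h2 h0
  linarith

/-- In finite dimension an injective Hessian is bounded below by some `1 / K`. The Taylor remainder
of the derivative, taken with constant `1 / (2 * K)`, is absorbed and costs a factor two. -/
lemma exists_error_bound [FiniteDimensional ℝ E] {g : E → ℝ} {p : E}
    (hd : DifferentiableAt ℝ (fderiv ℝ g) p) (h0 : fderiv ℝ g p = 0)
    (hn : ∀ u : E, (∀ v : E, fderiv ℝ (fderiv ℝ g) p u v = 0) → u = 0) :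
    ∃ c : ℝ, 0 < c ∧ ∀ᶠ q in 𝓝 p, ‖q - p‖ ≤ c * ‖fderiv ℝ g q‖ := by
  set T := fderiv ℝ (fderiv ℝ g) p with hT
  have hker : LinearMap.ker (T : E →ₗ[ℝ] (E →L[ℝ] ℝ)) = ⊥ := by
    rw [LinearMap.ker_eq_bot']
    intro u hu
    refine hn u fun v => ?_
    have : T u = 0 := hu
    rw [this]; rfl
  obtain ⟨K, hK, hanti⟩ := LinearMap.exists_antilipschitzWith _ hker
  have hK' : (0 : ℝ) < K := by exact_mod_cast hK
  refine ⟨2 * K, by positivity, ?_⟩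
  have ho := hd.hasFDerivAt.isLittleO.def (c := 1 / (2 * K)) (by positivity)
  filter_upwards [ho] with q hq
  rw [h0, sub_zero] at hq
  have h1 : ‖q - p‖ ≤ K * ‖T (q - p)‖ :=
    ZeroHomClass.bound_of_antilipschitz T hanti (q - p)
  have h2 : ‖T (q - p)‖ ≤ ‖fderiv ℝ g q‖ + ‖fderiv ℝ g q - T (q - p)‖ := by
    have := norm_sub_le (fderiv ℝ g q) (fderiv ℝ g q - T (q - p))
    simpa using this
  have h3 : ‖q - p‖ ≤ K * ‖fderiv ℝ g q‖ + K * (1 / (2 * K) * ‖q - p‖) := by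
    calc _ ≤ _ := h1
      _ ≤ K * (‖fderiv ℝ g q‖ + 1 / (2 * K) * ‖q - p‖) := by gcongr; linarith
      _ = _ := by ring
  have h4 : (K : ℝ) * (1 / (2 * K) * ‖q - p‖) = ‖q - p‖ / 2 := by field_simp
  linarith

lemma quadratic_upper {g : E → ℝ} {p : E} {K ε : ℝ} (hd : Differentiable ℝ g)
    (h0 : fderiv ℝ g p = 0) (hK0 : 0 ≤ K)
    (hK : ∀ q ∈ Metric.ball p ε, ‖fderiv ℝ g q - fderiv ℝ g p‖ ≤ K * ‖q - p‖)
    {q : E} (hq : q ∈ Metric.ball p ε) : g q - g p ≤ K * ‖q - p‖ ^ 2 := by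
  have hsub : segment ℝ p q ⊆ Metric.closedBall p ‖q - p‖ := by
    apply (convex_closedBall p ‖q - p‖).segment_subset
    · simp
    · simp [dist_eq_norm]
  have h := (convex_segment p q).norm_image_sub_le_of_norm_fderiv_le (f := g)
    (C := K * ‖q - p‖) (fun y _ => hd y) (fun y hy => by
      have hy' := mem_closedBall_iff_norm.1 (hsub hy)
      have := hK y (by rw [mem_ball_iff_norm] at hq ⊢; linarith)
      rw [h0, sub_zero] at this
      exact this.trans (by gcongr)) (left_mem_segment ℝ p q) (right_mem_segment ℝ p q)
  calc g q - g p ≤ ‖g q - g p‖ := Real.le_norm_self _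
    _ ≤ _ := h
    _ = _ := by ring

/-- Index zero is excluded here and below because an arbitrary starting point need not satisfy the
dual relation behind descent. -/
lemma tendsto_sub_succ_of_antitone {a : ℕ → ℝ} {m : ℝ} (hanti : ∀ k ≥ 1, a (k + 1) ≤ a k)
    (hm : ∀ k ≥ 1, m ≤ a k) :
    ∃ l, Tendsto a atTop (𝓝 l) ∧ ∀ k ≥ 1, l ≤ a k := by
  have hA : Antitone fun k => a (k + 1) := antitone_nat_of_succ_le fun k => hanti (k + 1) (by omega)
  have hb : BddBelow (Set.range fun k => a (k + 1)) :=
    ⟨m, by rintro _ ⟨k, rfl⟩; exact hm (k + 1) (by omega)⟩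
  have ht := tendsto_atTop_ciInf hA hb
  refine ⟨_, (tendsto_add_atTop_iff_nat 1).1 ht, fun k hk => ?_⟩
  obtain ⟨j, rfl⟩ : ∃ j, k = j + 1 := ⟨k - 1, by omega⟩
  exact ciInf_le hb j

omit [NormedSpace ℝ E] in
lemma tendsto_step_zero {p : ℕ → E} {g : E → ℝ} {c m : ℝ}
    (hdesc : ∀ k ≥ 1, ‖p (k + 1) - p k‖ ^ 2 ≤ c * (g (p k) - g (p (k + 1))))
    (hanti : ∀ k ≥ 1, g (p (k + 1)) ≤ g (p k))
    (hm : ∀ k ≥ 1, m ≤ g (p k)) :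
    Tendsto (fun k => ‖p (k + 1) - p k‖) atTop (𝓝 0) := by
  obtain ⟨l, hl, -⟩ := tendsto_sub_succ_of_antitone (a := fun k => g (p k)) hanti hm
  have h1 : Tendsto (fun k => c * (g (p k) - g (p (k + 1)))) atTop (𝓝 0) := by
    have := (hl.sub ((tendsto_add_atTop_iff_nat 1).2 hl)).const_mul c
    simpa using this
  have h2 : Tendsto (fun k => ‖p (k + 1) - p k‖ ^ 2) atTop (𝓝 0) := by
    refine tendsto_of_tendsto_of_tendsto_of_le_of_le' tendsto_const_nhds h1
      (Eventually.of_forall fun k => by positivity) ?_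
    filter_upwards [eventually_ge_atTop 1] with k hk using hdesc k hk
  have h3 := h2.sqrt
  simpa using h3

omit [NormedSpace ℝ E] in
-- Once the steps are small, the error bound traps the sequence near the cluster point. There the
-- gap in `g` is at most quadratic in the distance, hence in the last step, hence linear in the last
-- decrease of `g`; this contracts the gap by a fixed factor.
lemma linear_convergence_of_error_bound {p : ℕ → E} {g : E → ℝ} {ps : E} {c m c₁ C ε : ℝ}
    (hc : 0 ≤ c)
    (hdesc : ∀ k ≥ 1, ‖p (k + 1) - p k‖ ^ 2 ≤ c * (g (p k) - g (p (k + 1))))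
    (hanti : ∀ k ≥ 1, g (p (k + 1)) ≤ g (p k))
    (hm : ∀ k ≥ 1, m ≤ g (p k))
    (hps : MapClusterPt ps atTop p) (hcont : ContinuousAt g ps) (hε : 0 < ε) (hc₁ : 0 < c₁)
    (herr : ∀ k, p k ∈ Metric.ball ps ε → p (k + 1) ∈ Metric.ball ps ε →
      ‖p (k + 1) - ps‖ ≤ c₁ * ‖p (k + 1) - p k‖)
    (hC : 0 ≤ C) (hquad : ∀ q ∈ Metric.ball ps ε, g q - g ps ≤ C * ‖q - ps‖ ^ 2) :
    Tendsto p atTop (𝓝 ps) ∧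
      ∃ r : ℝ, 1 < r ∧ (fun k => g (p k) - g ps) =O[atTop] fun k : ℕ => (r ^ k)⁻¹ := by
  have hstep := tendsto_step_zero hdesc hanti hm
  -- The first bound keeps the next iterate in the `ε`-ball, so that `herr` applies; the second lets
  -- `herr` return it to the half-radius ball.
  set η := min (ε / 2) (ε / 2 / c₁) with hη
  have hη0 : 0 < η := by rw [hη]; positivity
  obtain ⟨K, hK⟩ := eventually_atTop.1 (hstep.eventually (gt_mem_nhds hη0))
  obtain ⟨k0, hk0K, hk0⟩ := (frequently_atTop.1
    (hps.frequently (Metric.ball_mem_nhds ps (half_pos hε)))) K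
  have hnext : ∀ k ≥ K, p k ∈ Metric.closedBall ps (ε / 2) →
      ‖p (k + 1) - ps‖ ≤ c₁ * ‖p (k + 1) - p k‖ ∧ p (k + 1) ∈ Metric.closedBall ps (ε / 2) := by
    intro k hk hpk
    have h1 := hK k hk
    rw [mem_closedBall_iff_norm] at hpk
    have h2 : ‖p (k + 1) - ps‖ < ε := by
      have := norm_add_le (p (k + 1) - p k) (p k - ps)
      rw [sub_add_sub_cancel] at this
      have := min_le_left (ε / 2) (ε / 2 / c₁)
      linarith
    have h3 := herr k (by rw [mem_ball_iff_norm]; linarith) (by rwa [mem_ball_iff_norm])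
    refine ⟨h3, ?_⟩
    rw [mem_closedBall_iff_norm]
    calc _ ≤ _ := h3
      _ ≤ c₁ * (ε / 2 / c₁) := by
        gcongr; exact h1.le.trans (min_le_right _ _)
      _ = ε / 2 := by field_simp
  have hall : ∀ k ≥ k0, p k ∈ Metric.closedBall ps (ε / 2) := by
    intro k hk
    induction k, hk using Nat.le_induction with
    | base => exact Metric.ball_subset_closedBall hk0
    | succ k hk ih => exact (hnext k (hk0K.trans hk) ih).2
  have hest : ∀ k ≥ k0, ‖p (k + 1) - ps‖ ≤ c₁ * ‖p (k + 1) - p k‖ := fun k hk =>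
    (hnext k (hk0K.trans hk) (hall k hk)).1
  have hconv : Tendsto p atTop (𝓝 ps) := by
    rw [← tendsto_add_atTop_iff_nat 1, tendsto_iff_norm_sub_tendsto_zero]
    refine tendsto_of_tendsto_of_tendsto_of_le_of_le' tendsto_const_nhds
      (by simpa using hstep.const_mul c₁) (Eventually.of_forall fun k => norm_nonneg _) ?_
    filter_upwards [eventually_ge_atTop k0] with k hk using hest k hk
  refine ⟨hconv, ?_⟩
  have hgconv : Tendsto (fun k => g (p k)) atTop (𝓝 (g ps)) := hcont.tendsto.comp hconv
  obtain ⟨l, hl, hlle⟩ := tendsto_sub_succ_of_antitone (a := fun k => g (p k)) hanti hm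
  have hleq : l = g ps := tendsto_nhds_unique hl hgconv
  subst hleq
  -- The added `1` keeps `D` positive when `C` or `c` vanishes.
  set D := C * c₁ ^ 2 * c + 1 with hD
  have hD1 : 1 ≤ D := by rw [hD]; have : 0 ≤ C * c₁ ^ 2 * c := by positivity
                         linarith
  set N := max k0 1 with hN
  have hrec : ∀ k ≥ N, (1 + 1 / D) * (g (p (k + 1)) - g ps) ≤ g (p k) - g ps := by
    intro k hk
    have hk0' : k0 ≤ k := (le_max_left _ _).trans hk
    have hk1 : 1 ≤ k := (le_max_right _ _).trans hk
    have hmem := hall (k + 1) (by omega)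
    rw [mem_closedBall_iff_norm] at hmem
    have h1 := hquad (p (k + 1)) (by rw [mem_ball_iff_norm]; linarith)
    have h2 := hest k hk0'
    have h3 := hdesc k hk1
    have h4 := hanti k hk1
    have h5 : g (p (k + 1)) - g ps ≤ D * (g (p k) - g (p (k + 1))) := by
      calc _ ≤ _ := h1
        _ ≤ C * (c₁ * ‖p (k + 1) - p k‖) ^ 2 := by gcongr
        _ = C * c₁ ^ 2 * ‖p (k + 1) - p k‖ ^ 2 := by ring
        _ ≤ C * c₁ ^ 2 * (c * (g (p k) - g (p (k + 1)))) := by gcongr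
        _ ≤ _ := by rw [hD]; nlinarith
    have h6 : 1 / D * (g (p (k + 1)) - g ps) ≤ g (p k) - g (p (k + 1)) := by
      rw [one_div, inv_mul_le_iff₀ (by linarith)]; exact h5
    linarith
  refine ⟨1 + 1 / D, by have : 0 < 1 / D := by positivity
                        linarith, ?_⟩
  have hr0 : 0 < 1 + 1 / D := by positivity
  have hpow : ∀ k ≥ N, (1 + 1 / D) ^ k * (g (p k) - g ps) ≤ (1 + 1 / D) ^ N * (g (p N) - g ps) := by
    intro k hk
    induction k, hk using Nat.le_induction with
    | base => exact le_rfl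
    | succ k hk ih =>
      refine le_trans ?_ ih
      rw [pow_succ, mul_assoc]
      exact mul_le_mul_of_nonneg_left (hrec k hk) (by positivity)
  refine Asymptotics.IsBigO.of_bound ((1 + 1 / D) ^ N * (g (p N) - g ps)) ?_
  filter_upwards [eventually_ge_atTop N] with k hk
  have hnn := hlle k ((le_max_right _ _).trans hk)
  rw [Real.norm_of_nonneg (by linarith), Real.norm_of_nonneg (by positivity)]
  rw [← div_eq_mul_inv, le_div_iff₀ (by positivity), mul_comm]
  exact hpow k hk

end Analysis

/-! ### Gradients and Fréchet derivatives -/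

section Gradient

variable {E : Type*} [NormedAddCommGroup E] [InnerProductSpace ℝ E] [CompleteSpace E]

lemma inner_gradient (f : E → ℝ) (x v : E) : inner ℝ (gradient f x) v = fderiv ℝ f x v := by
  simp [gradient]

lemma IsSmoothWith.fderiv_lipschitz {L : ℝ} {f : E → ℝ} (h : IsSmoothWith L f) (u v : E) :
    ‖fderiv ℝ f u - fderiv ℝ f v‖ ≤ L * ‖u - v‖ := by
  have := h.2 u v
  rwa [gradient, gradient, ← map_sub, LinearIsometryEquiv.norm_map] at this

omit [CompleteSpace E] in
lemma fderiv_eq_zero_of_isMinOn {f : E → ℝ} {x : E} (h : IsMinOn f Set.univ x) :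
    fderiv ℝ f x = 0 :=
  (h.isLocalMin Filter.univ_mem).fderiv_eq_zero

lemma modulus_le_smoothness [Nontrivial E] {m L : ℝ} {f : E → ℝ}
    (hf : StrongConvexOn Set.univ m f) (hd : Differentiable ℝ f) (h : IsSmoothWith L f) :
    m ≤ L := by
  obtain ⟨v, hv⟩ := exists_ne (0 : E)
  have h1 := strongConvex_monotone hf hd 0 v
  have h2 := (fderiv ℝ f v - fderiv ℝ f 0).le_opNorm (v - 0)
  have h3 := h.fderiv_lipschitz v 0
  have h4 := Real.le_norm_self ((fderiv ℝ f v - fderiv ℝ f 0) (v - 0))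
  rw [sub_zero] at h1 h2 h3 h4
  have hv' : 0 < ‖v‖ := norm_pos_iff.2 hv
  have h5 : m * ‖v‖ ^ 2 ≤ L * ‖v‖ ^ 2 := by nlinarith
  exact le_of_mul_le_mul_right h5 (by positivity)

end Gradient

/-! ### Spectral estimates for a matrix of full row rank -/

section Matrices

variable {nc nz : ℕ}

lemma inner_toEuclideanLin {m k : ℕ} (Q : Matrix (Fin m) (Fin k) ℝ) (w : Vec m) (z : Vec k) :
    inner ℝ w (Matrix.toEuclideanLin Q z) = inner ℝ (Matrix.toEuclideanLin Qᵀ w) z := by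
  simp only [EuclideanSpace.inner_eq_star_dotProduct, Matrix.toLpLin_apply, star_trivial]
  rw [Matrix.mulVec_transpose, dotProduct_comm, Matrix.dotProduct_mulVec, dotProduct_comm]

lemma toEuclideanLin_mul_apply {m k l : ℕ} (A : Matrix (Fin m) (Fin k) ℝ)
    (B : Matrix (Fin k) (Fin l) ℝ) (z : Vec l) :
    Matrix.toEuclideanLin (A * B) z = Matrix.toEuclideanLin A (Matrix.toEuclideanLin B z) := by
  simp [Matrix.toLpLin_apply]

lemma norm_toEuclideanLin_le {m k : ℕ} (A : Matrix (Fin m) (Fin k) ℝ) (z : Vec k) :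
    ‖Matrix.toEuclideanLin A z‖ ≤ ‖A‖ * ‖z‖ :=
  Matrix.l2_opNorm_mulVec A z

lemma posDef_mul_transpose {Q : Matrix (Fin nc) (Fin nz) ℝ} (hQ : Q.rank = nc) :
    (Q * Qᵀ).PosDef := by
  have h1 : (Q * Qᵀ).PosSemidef := by
    simpa using Matrix.posSemidef_self_mul_conjTranspose Q
  rw [h1.posDef_iff_isUnit]
  have h2 : (Q * Qᵀ).rank = nc := by rw [Matrix.rank_self_mul_transpose, hQ]
  rw [← Matrix.linearIndependent_rows_iff_isUnit, linearIndependent_iff_card_eq_finrank_span,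
    Set.finrank, ← Matrix.rank_eq_finrank_span_row, h2, Fintype.card_fin]

lemma mul_transpose_mul_inv {Q : Matrix (Fin nc) (Fin nz) ℝ} (hQ : Q.rank = nc) :
    (Q * Qᵀ) * (Q * Qᵀ)⁻¹ = 1 :=
  Matrix.mul_nonsing_inv _ ((Matrix.isUnit_iff_isUnit_det _).1 (posDef_mul_transpose hQ).isUnit)

lemma inv_mul_mul_transpose {Q : Matrix (Fin nc) (Fin nz) ℝ} (hQ : Q.rank = nc) :
    (Q * Qᵀ)⁻¹ * (Q * Qᵀ) = 1 :=
  Matrix.nonsing_inv_mul _ ((Matrix.isUnit_iff_isUnit_det _).1 (posDef_mul_transpose hQ).isUnit)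

lemma lamMin_mem {m : ℕ} (hm : 0 < m) {B : Matrix (Fin m) (Fin m) ℝ} (hB : B.IsHermitian) :
    lamMin B ∈ spectrum ℝ B := by
  have : Nonempty (Fin m) := ⟨⟨0, hm⟩⟩
  apply Set.Nonempty.csInf_mem
  · rw [hB.spectrum_real_eq_range_eigenvalues]
    exact Set.range_nonempty _
  · exact Matrix.finite_real_spectrum

open scoped MatrixOrder in
lemma lamMin_mul_norm_sq_le {m : ℕ} {B : Matrix (Fin m) (Fin m) ℝ} (hB : B.IsHermitian)
    (w : Vec m) : lamMin B * ‖w‖ ^ 2 ≤ inner ℝ w (Matrix.toEuclideanLin B w) := by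
  have h1 : algebraMap ℝ (Matrix (Fin m) (Fin m) ℝ) (lamMin B) ≤ B := by
    rw [algebraMap_le_iff_le_spectrum (ha := hB)]
    intro x hx
    exact csInf_le Matrix.finite_real_spectrum.bddBelow hx
  have h2 := (Matrix.le_iff.1 h1).dotProduct_mulVec_nonneg w.ofLp
  rw [Matrix.sub_mulVec, Algebra.algebraMap_eq_smul_one, Matrix.smul_mulVec, Matrix.one_mulVec,
    dotProduct_sub, dotProduct_smul, star_trivial, smul_eq_mul] at h2
  have h3 : ‖w‖ ^ 2 = w.ofLp ⬝ᵥ w.ofLp := by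
    rw [← real_inner_self_eq_norm_sq, EuclideanSpace.inner_eq_star_dotProduct, star_trivial]
  rw [h3, EuclideanSpace.inner_eq_star_dotProduct, Matrix.toLpLin_apply, star_trivial,
    dotProduct_comm (B *ᵥ w.ofLp)]
  linarith

lemma inner_mul_transpose (Q : Matrix (Fin nc) (Fin nz) ℝ) (w : Vec nc) :
    inner ℝ w (Matrix.toEuclideanLin (Q * Qᵀ) w) = ‖Matrix.toEuclideanLin Qᵀ w‖ ^ 2 := by
  rw [toEuclideanLin_mul_apply, inner_toEuclideanLin, real_inner_self_eq_norm_sq]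

lemma lamMin_le_norm_transpose_sq {Q : Matrix (Fin nc) (Fin nz) ℝ} (hQ : Q.rank = nc) (w : Vec nc) :
    lamMin (Q * Qᵀ) * ‖w‖ ^ 2 ≤ ‖Matrix.toEuclideanLin Qᵀ w‖ ^ 2 := by
  rw [← inner_mul_transpose]
  exact lamMin_mul_norm_sq_le (posDef_mul_transpose hQ).1 w

lemma lamMin_pos {Q : Matrix (Fin nc) (Fin nz) ℝ} (hQ : Q.rank = nc) (hnc : 0 < nc) :
    0 < lamMin (Q * Qᵀ) := by
  have h := posDef_mul_transpose hQ
  have h1 := lamMin_mem hnc h.1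
  rw [h.1.spectrum_real_eq_range_eigenvalues] at h1
  obtain ⟨i, hi⟩ := h1
  rw [← hi]
  exact h.eigenvalues_pos i

/-- `Qᵀ` maps an eigenvector of `Q Qᵀ` to one of `Qᵀ Q` with the same eigenvalue; positivity of the
eigenvalue keeps the image nonzero. -/
lemma lamMin_mem_spectrum_transpose_mul {Q : Matrix (Fin nc) (Fin nz) ℝ} (hQ : Q.rank = nc)
    (hnc : 0 < nc) : lamMin (Q * Qᵀ) ∈ spectrum ℝ (Qᵀ * Q) := by
  have h := lamMin_mem hnc (posDef_mul_transpose hQ).1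
  have hpos := lamMin_pos hQ hnc
  rw [← Matrix.spectrum_toLpLin 2, ← Module.End.hasEigenvalue_iff_mem_spectrum] at h ⊢
  obtain ⟨v, hv⟩ := h.exists_hasEigenvector
  have hv1 : Matrix.toEuclideanLin (Q * Qᵀ) v = lamMin (Q * Qᵀ) • v := hv.apply_eq_smul
  refine Module.End.hasEigenvalue_of_hasEigenvector (x := Matrix.toEuclideanLin Qᵀ v)
    (Module.End.hasEigenvector_iff.2 ⟨Module.End.mem_eigenspace_iff.2 ?_, ?_⟩)
  · change Matrix.toEuclideanLin (Qᵀ * Q) _ = _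
    rw [toEuclideanLin_mul_apply, ← toEuclideanLin_mul_apply Q, hv1, map_smul]
  · intro h0
    have h2 := lamMin_le_norm_transpose_sq hQ v
    rw [h0, norm_zero] at h2
    have h3 : 0 < ‖v‖ := norm_pos_iff.2 hv.2
    have : 0 < lamMin (Q * Qᵀ) * ‖v‖ ^ 2 := by positivity
    norm_num at h2
    linarith

/-- Transfers the lower bound on `ρ`, stated with `Qᵀ Q`, to `Q Qᵀ`; this inequality suffices. -/
lemma lamMinPos_transpose_mul {Q : Matrix (Fin nc) (Fin nz) ℝ} (hQ : Q.rank = nc) (hnc : 0 < nc) :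
    0 < lamMinPos (Qᵀ * Q) ∧ lamMinPos (Qᵀ * Q) ≤ lamMin (Q * Qᵀ) := by
  have hfin : {t : ℝ | t ∈ spectrum ℝ (Qᵀ * Q) ∧ 0 < t}.Finite :=
    Matrix.finite_real_spectrum.subset fun t ht => ht.1
  have hmem : lamMin (Q * Qᵀ) ∈ {t : ℝ | t ∈ spectrum ℝ (Qᵀ * Q) ∧ 0 < t} :=
    ⟨lamMin_mem_spectrum_transpose_mul hQ hnc, lamMin_pos hQ hnc⟩
  exact ⟨(Set.Nonempty.csInf_mem ⟨_, hmem⟩ hfin).2, csInf_le hfin.bddBelow hmem⟩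

/-- The minimum norm right inverse `Qᵀ (Q Qᵀ)⁻¹` of a matrix of full row rank. -/
noncomputable def rightInv (Q : Matrix (Fin nc) (Fin nz) ℝ) : Vec nc →ₗ[ℝ] Vec nz :=
  Matrix.toEuclideanLin (Qᵀ * (Q * Qᵀ)⁻¹)

lemma apply_rightInv {Q : Matrix (Fin nc) (Fin nz) ℝ} (hQ : Q.rank = nc) (r : Vec nc) :
    Matrix.toEuclideanLin Q (rightInv Q r) = r := by
  rw [rightInv, ← toEuclideanLin_mul_apply, ← Matrix.mul_assoc, mul_transpose_mul_inv hQ]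
  simp

lemma norm_rightInv_sq_le {Q : Matrix (Fin nc) (Fin nz) ℝ} (hQ : Q.rank = nc) (hnc : 0 < nc)
    (r : Vec nc) : lamMin (Q * Qᵀ) * ‖rightInv Q r‖ ^ 2 ≤ ‖r‖ ^ 2 := by
  set v := Matrix.toEuclideanLin (Q * Qᵀ)⁻¹ r with hv
  have h1 : rightInv Q r = Matrix.toEuclideanLin Qᵀ v := by
    rw [rightInv, toEuclideanLin_mul_apply]
  have h2 : ‖rightInv Q r‖ ^ 2 = inner ℝ v r := by
    rw [← real_inner_self_eq_norm_sq]
    nth_rewrite 1 [h1]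
    rw [← inner_toEuclideanLin, apply_rightInv hQ]
  have h3 := lamMin_le_norm_transpose_sq hQ v
  rw [← h1] at h3
  have hpos := lamMin_pos hQ hnc
  have h4 := real_inner_le_norm v r
  set a := ‖rightInv Q r‖
  set l := lamMin (Q * Qᵀ)
  -- Young's inequality, weighted so that `h3` absorbs the term in `v`.
  have h5 : 2 * a ^ 2 ≤ l * ‖v‖ ^ 2 + ‖r‖ ^ 2 / l := by
    have : l * ‖v‖ ^ 2 + ‖r‖ ^ 2 / l - 2 * (‖v‖ * ‖r‖) = (l * ‖v‖ - ‖r‖) ^ 2 / l := by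
      field_simp; ring
    have : 0 ≤ (l * ‖v‖ - ‖r‖) ^ 2 / l := by positivity
    linarith
  have h6 : a ^ 2 ≤ ‖r‖ ^ 2 / l := by linarith
  rw [le_div_iff₀ hpos] at h6
  linarith

/-- `(Q Qᵀ)⁻¹ Q` is a left inverse of `Qᵀ`. This is how its norm enters the threshold. -/
lemma norm_le_norm_transpose {Q : Matrix (Fin nc) (Fin nz) ℝ} (hQ : Q.rank = nc) (w : Vec nc) :
    ‖w‖ ≤ ‖(Q * Qᵀ)⁻¹ * Q‖ * ‖Matrix.toEuclideanLin Qᵀ w‖ := by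
  have h := norm_toEuclideanLin_le ((Q * Qᵀ)⁻¹ * Q) (Matrix.toEuclideanLin Qᵀ w)
  rw [← toEuclideanLin_mul_apply, Matrix.mul_assoc, inv_mul_mul_transpose hQ] at h
  simpa [Matrix.toLpLin_apply] using h

lemma nontrivial_of_rank {Q : Matrix (Fin nc) (Fin nz) ℝ} (hQ : Q.rank = nc) (hnc : 0 < nc) :
    Nontrivial (Vec nz) := by
  have : 0 < nz := by
    have := Matrix.rank_le_width Q
    omega
  have : Nonempty (Fin nz) := ⟨⟨0, this⟩⟩
  infer_instance

end Matrices

/-! ### The quadratic constraint map and the derivatives of the augmented Lagrangian -/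

section Quadratic

variable {n : ℕ} {ν : Fin n → ℕ} {nc nz : ℕ}

lemma norm_toLp_coords (x : BlockVec ν) : ‖(WithLp.toLp 2 (coords x) : EuclideanSpace ℝ (Coord ν))‖
    = ‖x‖ := by
  have : ‖(WithLp.toLp 2 (coords x) : EuclideanSpace ℝ (Coord ν))‖ ^ 2 = ‖x‖ ^ 2 := by
    rw [EuclideanSpace.norm_sq_eq, PiLp.norm_sq_eq_of_L2, Fintype.sum_sigma]
    simp_rw [EuclideanSpace.norm_sq_eq]
    rfl
  exact (sq_eq_sq₀ (norm_nonneg _) (norm_nonneg _)).1 this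

lemma abs_coords_form_le (M : Matrix (Coord ν) (Coord ν) ℝ) (x : BlockVec ν) :
    |coords x ⬝ᵥ (M *ᵥ coords x)| ≤ ‖M‖ * ‖x‖ ^ 2 := by
  set v : EuclideanSpace ℝ (Coord ν) := WithLp.toLp 2 (coords x) with hv
  have h1 : coords x ⬝ᵥ (M *ᵥ coords x) = inner ℝ v (WithLp.toLp 2 (M *ᵥ v.ofLp)) := by
    rw [EuclideanSpace.inner_eq_star_dotProduct, star_trivial, dotProduct_comm]
  have h2 : ‖(WithLp.toLp 2 (M *ᵥ v.ofLp) : EuclideanSpace ℝ (Coord ν))‖ ≤ ‖M‖ * ‖v‖ :=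
    Matrix.l2_opNorm_mulVec M v
  rw [h1]
  calc _ ≤ ‖v‖ * ‖(WithLp.toLp 2 (M *ᵥ v.ofLp) : EuclideanSpace ℝ (Coord ν))‖ :=
        abs_real_inner_le_norm _ _
    _ ≤ ‖v‖ * (‖M‖ * ‖v‖) := by gcongr
    _ = _ := by rw [hv, norm_toLp_coords]; ring

lemma norm_le_sqrt_mul {v : Vec nc} {c : ℝ} (hc : 0 ≤ c) (h : ∀ i, |v i| ≤ c) :
    ‖v‖ ≤ √nc * c := by
  rw [EuclideanSpace.norm_eq, ← Real.sqrt_sq hc, ← Real.sqrt_mul (Nat.cast_nonneg nc)]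
  apply Real.sqrt_le_sqrt
  calc _ ≤ ∑ _i : Fin nc, c ^ 2 := Finset.sum_le_sum fun i _ => by
        rw [Real.norm_eq_abs]; gcongr; exact h i
    _ = _ := by simp

/-- The symmetric bilinear map whose diagonal has components `xᵀ C_i x`. -/
noncomputable def bilin (C : QuadPart ν nc) : BlockVec ν →L[ℝ] BlockVec ν →L[ℝ] Vec nc :=
  LinearMap.toContinuousBilinearMap <| LinearMap.mk₂ ℝ
    (fun x y => WithLp.toLp 2 fun i =>
      (coords x ⬝ᵥ (C i *ᵥ coords y) + coords y ⬝ᵥ (C i *ᵥ coords x)) / 2)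
    (fun x x' y => by
      have : coords (x + x') = coords x + coords x' := rfl
      ext i; simp [this, Matrix.mulVec_add]; ring)
    (fun c x y => by
      have : coords (c • x) = c • coords x := rfl
      ext i; simp [this, Matrix.mulVec_smul]; ring)
    (fun x y y' => by
      have : coords (y + y') = coords y + coords y' := rfl
      ext i; simp [this, Matrix.mulVec_add]; ring)
    (fun c x y => by
      have : coords (c • y) = c • coords y := rfl
      ext i; simp [this, Matrix.mulVec_smul]; ring)

lemma bilin_apply (C : QuadPart ν nc) (x y : BlockVec ν) (i : Fin nc) : bilin C x y i =
    (coords x ⬝ᵥ (C i *ᵥ coords y) + coords y ⬝ᵥ (C i *ᵥ coords x)) / 2 := rfl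

lemma bilin_symm (C : QuadPart ν nc) (x y : BlockVec ν) : bilin C x y = bilin C y x := by
  ext i
  rw [bilin_apply, bilin_apply, add_comm]

/-- The linear part of the constraint map. -/
noncomputable def linPart (P : Data n ν nc nz) : BlockVec ν →L[ℝ] Vec nc :=
  LinearMap.toContinuousLinearMap
    { toFun := fun x => WithLp.toLp 2 fun i => inner ℝ (P.d i) x
      map_add' := fun x y => by ext i; simp [inner_add_right]
      map_smul' := fun c x => by ext i; simp [inner_smul_right] }

lemma constraintMap_eq (P : Data n ν nc nz) (C : QuadPart ν nc) (x : BlockVec ν) :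
    constraintMap P C x = (1 / 2 : ℝ) • bilin C x x + linPart P x + WithLp.toLp 2 P.e := by
  ext i
  simp only [constraintMap, linPart, PiLp.add_apply, PiLp.smul_apply, bilin_apply, smul_eq_mul,
    LinearMap.coe_toContinuousLinearMap', LinearMap.coe_mk, AddHom.coe_mk]
  ring

/-- The derivative of the constraint map. -/
noncomputable def jac (P : Data n ν nc nz) (C : QuadPart ν nc) (x : BlockVec ν) :
    BlockVec ν →L[ℝ] Vec nc :=
  bilin C x + linPart P

lemma jac_apply (P : Data n ν nc nz) (C : QuadPart ν nc) (x a : BlockVec ν) :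
    jac P C x a = bilin C x a + linPart P a := rfl

lemma constraintMap_add (P : Data n ν nc nz) (C : QuadPart ν nc) (x h : BlockVec ν) :
    constraintMap P C (x + h) =
      constraintMap P C x + jac P C x h + (1 / 2 : ℝ) • bilin C h h := by
  simp only [constraintMap_eq, map_add, add_apply, jac_apply,
    bilin_symm C h x]
  module

lemma norm_le_normC (C : QuadPart ν nc) (i : Fin nc) : ‖C i‖ ≤ normC C :=
  le_ciSup (f := fun i => ‖C i‖) (Set.finite_range _).bddAbove i

lemma normC_nonneg (C : QuadPart ν nc) : 0 ≤ normC C := Real.iSup_nonneg fun _ => norm_nonneg _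

lemma normd_nonneg (P : Data n ν nc nz) : 0 ≤ normd P := Real.iSup_nonneg fun _ => norm_nonneg _

lemma norme_nonneg (P : Data n ν nc nz) : 0 ≤ norme P := Real.iSup_nonneg fun _ => abs_nonneg _

/-- On the diagonal, symmetrising the `C i` changes nothing, so their symmetry is not needed. The
factor `√nc` comes from passing from components to the Euclidean norm. -/
lemma norm_bilin_self_le (C : QuadPart ν nc) (h : BlockVec ν) :
    ‖bilin C h h‖ ≤ √nc * (normC C * ‖h‖ ^ 2) := by
  refine norm_le_sqrt_mul (mul_nonneg (normC_nonneg C) (by positivity)) fun i => ?_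
  rw [bilin_apply, add_self_div_two]
  exact (abs_coords_form_le (C i) h).trans
    (mul_le_mul_of_nonneg_right (norm_le_normC C i) (by positivity))

lemma norm_constraintMap_le (P : Data n ν nc nz) (C : QuadPart ν nc) (x : BlockVec ν) :
    ‖constraintMap P C x‖ ≤ √nc * (normC C * ‖x‖ ^ 2 / 2 + normd P * ‖x‖ + norme P) := by
  have h0 := normC_nonneg C
  have h1 := normd_nonneg P
  have h2 := norme_nonneg P
  refine norm_le_sqrt_mul (by positivity) fun i => ?_
  change |(coords x ⬝ᵥ (C i *ᵥ coords x)) / 2 + inner ℝ (P.d i) x + P.e i| ≤ _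
  have h3 : |coords x ⬝ᵥ (C i *ᵥ coords x)| ≤ normC C * ‖x‖ ^ 2 :=
    (abs_coords_form_le (C i) x).trans
      (mul_le_mul_of_nonneg_right (norm_le_normC C i) (by positivity))
  have h4 : |inner ℝ (P.d i) x| ≤ normd P * ‖x‖ :=
    (abs_real_inner_le_norm _ _).trans (mul_le_mul_of_nonneg_right
      (le_ciSup (f := fun i => ‖P.d i‖) (Set.finite_range _).bddAbove i) (norm_nonneg _))
  have h5 : |P.e i| ≤ norme P := le_ciSup (f := fun i => |P.e i|) (Set.finite_range _).bddAbove i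
  refine (abs_add_three _ _ _).trans ?_
  rw [abs_div, abs_two]
  linarith

/-- The augmented Lagrangian without the indicator functions. -/
noncomputable def lagR (P : Data n ν nc nz) (C : QuadPart ν nc) (ρ : ℝ)
    (p : BlockVec ν × Vec nz × Vec nc) : ℝ :=
  P.f p.1 + (P.φ p.2.1 + inner ℝ p.2.2 (residual P C p.1 p.2.1)
    + ρ / 2 * ‖residual P C p.1 p.2.1‖ ^ 2)

/-- The matrix `Q` as a continuous linear map. -/
noncomputable def slackMap (P : Data n ν nc nz) : Vec nz →L[ℝ] Vec nc :=
  LinearMap.toContinuousLinearMap (Matrix.toEuclideanLin P.Q)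

lemma residual_eq (P : Data n ν nc nz) (C : QuadPart ν nc) (x : BlockVec ν) (z : Vec nz) :
    residual P C x z = constraintMap P C x + slackMap P z := rfl

lemma hasFDerivAt_constraintMap (P : Data n ν nc nz) (C : QuadPart ν nc) (x : BlockVec ν) :
    HasFDerivAt (constraintMap P C) (jac P C x) x := by
  have h1 : HasFDerivAt (fun x => bilin C x x) _ x :=
    (bilin C).hasFDerivAt_of_bilinear (hasFDerivAt_id x) (hasFDerivAt_id x)
  have h2 := ((h1.const_smul (1 / 2 : ℝ)).add (linPart P).hasFDerivAt).add_const
    (WithLp.toLp 2 P.e)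
  have h3 : constraintMap P C =
      fun x => (1 / 2 : ℝ) • bilin C x x + linPart P x + WithLp.toLp 2 P.e :=
    funext (constraintMap_eq P C)
  rw [h3]
  refine h2.congr_fderiv ?_
  ext1 a
  change (1 / 2 : ℝ) • (bilin C x a + bilin C a x) + linPart P a = bilin C x a + linPart P a
  rw [bilin_symm C a x]
  module

lemma contDiff_constraintMap (P : Data n ν nc nz) (C : QuadPart ν nc) :
    ContDiff ℝ 2 (constraintMap P C) := by
  have h3 : constraintMap P C =
      fun x => (1 / 2 : ℝ) • bilin C x x + linPart P x + WithLp.toLp 2 P.e :=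
    funext (constraintMap_eq P C)
  rw [h3]
  have h1 : ContDiff ℝ 2 fun x : BlockVec ν => bilin C x x :=
    (bilin C).contDiff.clm_apply contDiff_id
  fun_prop

lemma contDiff_residual (P : Data n ν nc nz) (C : QuadPart ν nc) :
    ContDiff ℝ 2 fun p : BlockVec ν × Vec nz × Vec nc => residual P C p.1 p.2.1 := by
  simp only [residual_eq]
  have := contDiff_constraintMap P C
  fun_prop

lemma contDiff_lagR {P : Data n ν nc nz} (hf : ContDiff ℝ 2 P.f) (hφ : ContDiff ℝ 2 P.φ)
    (C : QuadPart ν nc) (ρ : ℝ) : ContDiff ℝ 2 (lagR P C ρ) := by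
  have h := contDiff_residual P C
  have h1 := h.norm_sq ℝ
  have h2 := ContDiff.inner ℝ
    (contDiff_snd.comp contDiff_snd : ContDiff ℝ 2 fun p : BlockVec ν × Vec nz × Vec nc => p.2.2) h
  unfold lagR
  fun_prop

lemma hasDerivAt_residual_line (P : Data n ν nc nz) (C : QuadPart ν nc)
    (p v : BlockVec ν × Vec nz × Vec nc) :
    HasDerivAt (fun t : ℝ => residual P C (p.1 + t • v.1) (p.2.1 + t • v.2.1))
      (jac P C p.1 v.1 + slackMap P v.2.1) 0 := by
  have hx : HasDerivAt (fun t : ℝ => p.1 + t • v.1) v.1 0 := by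
    simpa using ((hasDerivAt_id (0 : ℝ)).smul_const v.1).const_add p.1
  have hz : HasDerivAt (fun t : ℝ => p.2.1 + t • v.2.1) v.2.1 0 := by
    simpa using ((hasDerivAt_id (0 : ℝ)).smul_const v.2.1).const_add p.2.1
  have hA := (hasFDerivAt_constraintMap P C (p.1 + (0 : ℝ) • v.1)).comp_hasDerivAt 0 hx
  have hQ := (slackMap P).hasFDerivAt.comp_hasDerivAt (0 : ℝ) hz
  have := hA.add hQ
  simp only [zero_smul, add_zero] at this
  exact this

/-- The derivative along a line is computed by one-variable rules and identified by uniqueness. The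
Hessian below is obtained by differentiating this formula in the same way. -/
lemma fderiv_lagR_apply {P : Data n ν nc nz} (hf : ContDiff ℝ 2 P.f) (hφ : ContDiff ℝ 2 P.φ)
    (C : QuadPart ν nc) (ρ : ℝ) (p v : BlockVec ν × Vec nz × Vec nc) :
    fderiv ℝ (lagR P C ρ) p v = fderiv ℝ P.f p.1 v.1 + fderiv ℝ P.φ p.2.1 v.2.1
      + inner ℝ (p.2.2 + ρ • residual P C p.1 p.2.1) (jac P C p.1 v.1 + slackMap P v.2.1)
      + inner ℝ v.2.2 (residual P C p.1 p.2.1) := by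
  have hd : Differentiable ℝ (lagR P C ρ) := (contDiff_lagR hf hφ C ρ).differentiable (by norm_num)
  have h1 := hasDerivAt_line hd p v 0
  simp only [zero_smul, add_zero] at h1
  have hfl := hasDerivAt_line (hf.differentiable (by norm_num)) p.1 v.1 0
  have hφl := hasDerivAt_line (hφ.differentiable (by norm_num)) p.2.1 v.2.1 0
  have hw : HasDerivAt (fun t : ℝ => p.2.2 + t • v.2.2) v.2.2 0 := by
    simpa using ((hasDerivAt_id (0 : ℝ)).smul_const v.2.2).const_add p.2.2
  have hr := hasDerivAt_residual_line P C p v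
  have h2 := hfl.add ((hφl.add (hw.inner ℝ hr)).add ((hr.norm_sq).const_mul (ρ / 2)))
  have h3 := h1.unique h2
  rw [h3]
  simp only [zero_smul, add_zero, inner_add_left, inner_add_right, inner_smul_left]
  simp only [conj_trivial]
  ring

lemma hessian_lagR_apply {P : Data n ν nc nz} (hf : ContDiff ℝ 2 P.f) (hφ : ContDiff ℝ 2 P.φ)
    (C : QuadPart ν nc) (ρ : ℝ) (p u v : BlockVec ν × Vec nz × Vec nc) :
    fderiv ℝ (fderiv ℝ (lagR P C ρ)) p u v =
      fderiv ℝ (fderiv ℝ P.f) p.1 u.1 v.1 + fderiv ℝ (fderiv ℝ P.φ) p.2.1 u.2.1 v.2.1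
      + inner ℝ (u.2.2 + ρ • (jac P C p.1 u.1 + slackMap P u.2.1))
          (jac P C p.1 v.1 + slackMap P v.2.1)
      + inner ℝ (p.2.2 + ρ • residual P C p.1 p.2.1) (bilin C u.1 v.1)
      + inner ℝ v.2.2 (jac P C p.1 u.1 + slackMap P u.2.1) := by
  have hd : Differentiable ℝ (fderiv ℝ (lagR P C ρ)) :=
    ((contDiff_lagR hf hφ C ρ).fderiv_right (m := 1) (by norm_num)).differentiable (by norm_num)
  have h1 := (hasDerivAt_line hd p u 0).clm_apply (hasDerivAt_const 0 v)
  simp only [zero_smul, add_zero, map_zero] at h1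
  have hfl := (hasDerivAt_line ((hf.fderiv_right (m := 1) (by norm_num)).differentiable
    (by norm_num)) p.1 u.1 0).clm_apply (hasDerivAt_const 0 v.1)
  have hφl := (hasDerivAt_line ((hφ.fderiv_right (m := 1) (by norm_num)).differentiable
    (by norm_num)) p.2.1 u.2.1 0).clm_apply (hasDerivAt_const 0 v.2.1)
  have hx : HasDerivAt (fun t : ℝ => p.1 + t • u.1) u.1 0 := by
    simpa using ((hasDerivAt_id (0 : ℝ)).smul_const u.1).const_add p.1
  have hw : HasDerivAt (fun t : ℝ => p.2.2 + t • u.2.2) u.2.2 0 := by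
    simpa using ((hasDerivAt_id (0 : ℝ)).smul_const u.2.2).const_add p.2.2
  have hr := hasDerivAt_residual_line P C p u
  have hJ : HasDerivAt (fun t : ℝ => jac P C (p.1 + t • u.1) v.1 + slackMap P v.2.1)
      (bilin C u.1 v.1) 0 := by
    have hB := ((bilin C).hasFDerivAt.comp_hasDerivAt (0 : ℝ) hx).clm_apply
      (hasDerivAt_const 0 v.1)
    have := (hB.add_const (linPart P v.1)).add_const (slackMap P v.2.1)
    simpa [jac_apply] using this
  have h2 := ((hfl.add hφl).add ((hw.add (hr.const_smul ρ)).inner ℝ hJ)).add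
    ((hasDerivAt_const (0 : ℝ) v.2.2).inner ℝ hr)
  have h3 := (h1.congr_of_eventuallyEq (f₁ := _) (Eventually.of_forall fun t =>
    (fderiv_lagR_apply hf hφ C ρ (p + t • u) v).symm)).unique h2
  rw [h3]
  simp only [zero_smul, add_zero, map_zero, inner_zero_left, Pi.add_apply, Pi.smul_apply]
  ring

end Quadratic

/-! ### Feasible set and block replacement -/

section Blocks

variable {n : ℕ} {ν : Fin n → ℕ} {nc nz : ℕ}

/-- The product of the sets `X_i`. -/
def feasSet (P : Data n ν nc nz) : Set (BlockVec ν) := {x | ∀ i, x i ∈ P.X i}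

lemma objF_of_mem {P : Data n ν nc nz} {x : BlockVec ν} (hx : x ∈ feasSet P) :
    objF P x = (P.f x : EReal) := by
  have : ∀ i, indicatorFn (P.X i) (x i) = 0 := fun i => if_pos (hx i)
  simp [objF, this]

lemma objF_of_notMem {P : Data n ν nc nz} {x : BlockVec ν} (hx : x ∉ feasSet P) :
    objF P x = ⊤ := by
  obtain ⟨i, hi⟩ := not_forall.1 hx
  have h0 : ∀ j ∈ Finset.univ, 0 ≤ indicatorFn (P.X j) (x j) := fun j _ => by
    unfold indicatorFn; split_ifs <;> simp
  have h1 : (⊤ : EReal) ≤ ∑ j, indicatorFn (P.X j) (x j) := by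
    have := Finset.single_le_sum h0 (Finset.mem_univ i)
    rwa [indicatorFn, if_neg hi] at this
  rw [objF, top_le_iff.1 h1, EReal.coe_add_top]

lemma lagrangian_of_mem {P : Data n ν nc nz} {C : QuadPart ν nc} {ρ : ℝ}
    {p : BlockVec ν × Vec nz × Vec nc} (hx : p.1 ∈ feasSet P) :
    lagrangian P C ρ p = (lagR P C ρ p : EReal) := by
  rw [lagrangian, objF_of_mem hx, lagR, EReal.coe_add (P.f p.1)]

lemma lagrangian_of_notMem {P : Data n ν nc nz} {C : QuadPart ν nc} {ρ : ℝ}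
    {p : BlockVec ν × Vec nz × Vec nc} (hx : p.1 ∉ feasSet P) :
    lagrangian P C ρ p = ⊤ := by
  rw [lagrangian, objF_of_notMem hx, EReal.top_add_coe]

lemma setBlock_same (x : BlockVec ν) (i : Fin n) (u : Vec (ν i)) : setBlock x i u i = u := by
  simp [setBlock]

lemma setBlock_of_ne (x : BlockVec ν) {i j : Fin n} (h : j ≠ i) (u : Vec (ν i)) :
    setBlock x i u j = x j := by
  simp [setBlock, h]

lemma blockVec_ext {x y : BlockVec ν} (h : ∀ j, x j = y j) : x = y := PiLp.ext h

lemma setBlock_combo (x : BlockVec ν) (i : Fin n) (u v : Vec (ν i)) {a b : ℝ} (hab : a + b = 1) :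
    setBlock x i (a • u + b • v) = a • setBlock x i u + b • setBlock x i v := by
  refine blockVec_ext fun j => ?_
  by_cases h : j = i
  · subst h; simp [setBlock_same]
  · simp only [PiLp.add_apply, PiLp.smul_apply, setBlock_of_ne x h, ← add_smul, hab, one_smul]

lemma setBlock_eq_add_single (x : BlockVec ν) (i : Fin n) (h : Vec (ν i)) :
    setBlock x i (x i + h) = x + PiLp.single 2 i h := by
  refine blockVec_ext fun j => ?_
  by_cases hj : j = i
  · subst hj; simp [setBlock_same]
  · simp [setBlock_of_ne x hj, hj]

lemma norm_setBlock_sub (x : BlockVec ν) (i : Fin n) (u v : Vec (ν i)) :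
    ‖setBlock x i u - setBlock x i v‖ = ‖u - v‖ := by
  have : setBlock x i u - setBlock x i v = PiLp.single 2 i (u - v) := by
    refine blockVec_ext fun j => ?_
    by_cases hj : j = i
    · subst hj; simp [setBlock_same]
    · simp [setBlock_of_ne x hj, hj]
  rw [this, PiLp.norm_single]

lemma setBlock_self (x : BlockVec ν) (i : Fin n) : setBlock x i (x i) = x := by
  refine blockVec_ext fun j => ?_
  by_cases hj : j = i
  · subst hj; rw [setBlock_same]
  · rw [setBlock_of_ne x hj]

/-- The block vector whose first `m` blocks come from `y` and whose other blocks come from `x`. -/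
def hybrid (y x : BlockVec ν) (m : ℕ) : BlockVec ν :=
  WithLp.toLp 2 (fun j : Fin n => if j.val < m then y j else x j)

lemma hybrid_apply (y x : BlockVec ν) (m : ℕ) (j : Fin n) :
    hybrid y x m j = if j.val < m then y j else x j := rfl

/-- Counting updated blocks by a natural number includes the state before any update, where the
induction over blocks starts; hence the shift by one. -/
lemma sweep_eq_hybrid (y x : BlockVec ν) (i : Fin n) : sweep y x i = hybrid y x (i.val + 1) := by
  refine blockVec_ext fun j => ?_
  change (if j ≤ i then y j else x j) = _
  rw [hybrid_apply]
  simp only [Fin.le_def, Nat.lt_succ_iff]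

lemma hybrid_zero (y x : BlockVec ν) : hybrid y x 0 = x :=
  blockVec_ext fun j => by simp [hybrid_apply]

lemma hybrid_last (y x : BlockVec ν) : hybrid y x n = y :=
  blockVec_ext fun j => by simp [hybrid_apply]

lemma setBlock_sweep (y x : BlockVec ν) (i : Fin n) :
    setBlock (sweep y x i) i (x i) = hybrid y x i.val := by
  refine blockVec_ext fun j => ?_
  by_cases h : j = i
  · subst h; simp [setBlock_same, hybrid_apply]
  · have : j.val ≠ i.val := fun h' => h (Fin.ext h')
    rw [setBlock_of_ne _ h, sweep_eq_hybrid, hybrid_apply, hybrid_apply]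
    by_cases h2 : j.val < i.val
    · rw [if_pos h2, if_pos (by omega)]
    · rw [if_neg h2, if_neg (by omega)]

/-- Pythagoras: the block updates are orthogonal, so the gains of one sweep add up to the squared
length of the whole step. -/
lemma norm_hybrid_succ_sq (y x : BlockVec ν) (i : Fin n) :
    ‖hybrid y x (i.val + 1) - x‖ ^ 2 = ‖hybrid y x i.val - x‖ ^ 2 + ‖x i - y i‖ ^ 2 := by
  rw [PiLp.norm_sq_eq_of_L2, PiLp.norm_sq_eq_of_L2]
  have h : ‖x i - y i‖ ^ 2 = ∑ j, if j = i then ‖x j - y j‖ ^ 2 else 0 := by simp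
  rw [h, ← Finset.sum_add_distrib]
  refine Finset.sum_congr rfl fun j _ => ?_
  rw [PiLp.sub_apply, PiLp.sub_apply, hybrid_apply, hybrid_apply]
  by_cases hj : j = i
  · subst hj; simp [norm_sub_rev]
  · have : j.val ≠ i.val := fun h' => hj (Fin.ext h')
    rw [if_neg hj, add_zero]
    by_cases h2 : j.val < i.val
    · rw [if_pos h2, if_pos (by omega)]
    · rw [if_neg h2, if_neg (by omega)]

lemma norm_sub_hybrid_le (y x : BlockVec ν) (m : ℕ) : ‖y - hybrid y x m‖ ≤ ‖y - x‖ := by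
  rw [← sq_le_sq₀ (norm_nonneg _) (norm_nonneg _), PiLp.norm_sq_eq_of_L2, PiLp.norm_sq_eq_of_L2]
  refine Finset.sum_le_sum fun j _ => ?_
  rw [PiLp.sub_apply, PiLp.sub_apply, hybrid_apply]
  split_ifs
  · simp
  · exact le_rfl

end Blocks

/-! ### Convexity of the penalty of an affine residual -/

section Penalty

variable {E W : Type*} [NormedAddCommGroup E] [NormedSpace ℝ E] [NormedAddCommGroup W]
  [InnerProductSpace ℝ W]

lemma norm_combo_sq_le (r s : W) {a b : ℝ} (ha : 0 ≤ a) (hb : 0 ≤ b) (hab : a + b = 1) :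
    ‖a • r + b • s‖ ^ 2 ≤ a * ‖r‖ ^ 2 + b * ‖s‖ ^ 2 := by
  have h1 : ‖a • r + b • s‖ ≤ a * ‖r‖ + b * ‖s‖ := by
    refine (norm_add_le _ _).trans ?_
    rw [norm_smul, norm_smul, Real.norm_of_nonneg ha, Real.norm_of_nonneg hb]
  have h2 : ‖a • r + b • s‖ ^ 2 ≤ (a * ‖r‖ + b * ‖s‖) ^ 2 := by gcongr
  have h3 : a * ‖r‖ ^ 2 + b * ‖s‖ ^ 2 - (a * ‖r‖ + b * ‖s‖) ^ 2
      = a * b * (‖r‖ - ‖s‖) ^ 2 := by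
    obtain rfl : b = 1 - a := by linarith
    ring
  have h4 : 0 ≤ a * b * (‖r‖ - ‖s‖) ^ 2 := by positivity
  linarith

/-- An affine residual makes both added terms convex, so the modulus of `F` survives. Multi-affinity
of the constraint serves to apply this block by block. -/
lemma strongConvexOn_add_penalty {s : Set E} {m ρ : ℝ} {F : E → ℝ} {r : E → W} (w : W)
    (hρ : 0 ≤ ρ) (hF : StrongConvexOn s m F)
    (hr : ∀ (u v : E) (a b : ℝ), a + b = 1 → r (a • u + b • v) = a • r u + b • r v) :
    StrongConvexOn s m fun u => F u + (inner ℝ w (r u) + ρ / 2 * ‖r u‖ ^ 2) := by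
  refine ⟨hF.1, fun u hu v hv a b ha hb hab => ?_⟩
  have h1 := hF.2 hu hv ha hb hab
  have h2 := norm_combo_sq_le (r u) (r v) ha hb hab
  simp only [smul_eq_mul, hr u v a b hab, inner_add_right, inner_smul_right] at h1 ⊢
  have h3 := mul_le_mul_of_nonneg_left h2 (by positivity : 0 ≤ ρ / 2)
  linarith

end Penalty

/-! ### Descent along the iterates and a lower bound for the Lagrangian -/

section Iterates

variable {n : ℕ} {ν : Fin n → ℕ} {nc nz : ℕ} {P : Data n ν nc nz} {C : QuadPart ν nc}
  {μf Lf μφ Lφ ρ : ℝ} {xf : BlockVec ν} {zφ : Vec nz}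

lemma strongConvexOn_setBlock (hA : Assumptions P μf Lf μφ Lφ ρ xf zφ) (hC : IsMultiAffine P C)
    (y : BlockVec ν) (i : Fin n) (z : Vec nz) (w : Vec nc) :
    StrongConvexOn (P.X i) μf fun u : Vec (ν i) => P.f (setBlock y i u) +
      (inner ℝ w (residual P C (setBlock y i u) z)
        + ρ / 2 * ‖residual P C (setBlock y i u) z‖ ^ 2) := by
  refine strongConvexOn_add_penalty (r := fun u => residual P C (setBlock y i u) z) w hA.ρ_pos.le
    ⟨hA.X_convex i, fun u _ v _ a b ha hb hab => ?_⟩ fun u v a b hab => ?_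
  · have := hA.f_strong.2 (Set.mem_univ (setBlock y i u)) (Set.mem_univ (setBlock y i v)) ha hb hab
    rw [norm_setBlock_sub, ← setBlock_combo y i u v hab] at this
    exact this
  · obtain ⟨g, hg⟩ := hC i y
    simp only [residual, hg, Convex.combo_affine_apply hab]
    rw [smul_add, smul_add, add_add_add_comm, ← add_smul, hab, one_smul]

lemma strongConvexOn_slack (hA : Assumptions P μf Lf μφ Lφ ρ xf zφ)
    (x : BlockVec ν) (w : Vec nc) :
    StrongConvexOn Set.univ μφ fun z : Vec nz => P.φ z +
      (inner ℝ w (residual P C x z) + ρ / 2 * ‖residual P C x z‖ ^ 2) := by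
  refine strongConvexOn_add_penalty (r := fun z => residual P C x z) w hA.ρ_pos.le hA.φ_strong
    fun u v a b hab => ?_
  simp only [residual, map_add, map_smul]
  rw [smul_add, smul_add, add_add_add_comm, ← add_smul, hab, one_smul]

variable {x : ℕ → BlockVec ν} {z : ℕ → Vec nz} {w : ℕ → Vec nc}

/-- Leaving `P.X i` would cost `⊤`, whereas keeping the old block has finite cost. -/
lemma IsADMM.block_step (hI : IsADMM P C ρ x z w) {k : ℕ} {i : Fin n}
    (hy : hybrid (x (k + 1)) (x k) i.val ∈ feasSet P) :
    hybrid (x (k + 1)) (x k) (i.val + 1) ∈ feasSet P := by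
  by_contra hcon
  have h := hI.x_step k i (x k i)
  rw [setBlock_sweep, sweep_eq_hybrid, lagrangian_of_notMem (by exact hcon),
    lagrangian_of_mem (by exact hy)] at h
  exact EReal.coe_ne_top _ (top_le_iff.1 h)

lemma setBlock_mem {y : BlockVec ν} (hy : y ∈ feasSet P) {i : Fin n} {u : Vec (ν i)}
    (hu : u ∈ P.X i) : setBlock y i u ∈ feasSet P := by
  intro j
  by_cases h : j = i
  · subst h; rwa [setBlock_same]
  · rw [setBlock_of_ne _ h]; exact hy j

lemma IsADMM.block_min (hI : IsADMM P C ρ x z w) {k : ℕ} {i : Fin n}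
    (hy : hybrid (x (k + 1)) (x k) (i.val + 1) ∈ feasSet P) {u : Vec (ν i)} (hu : u ∈ P.X i) :
    lagR P C ρ (hybrid (x (k + 1)) (x k) (i.val + 1), z k, w k) ≤
      lagR P C ρ (setBlock (hybrid (x (k + 1)) (x k) (i.val + 1)) i u, z k, w k) := by
  have h := hI.x_step k i u
  rw [sweep_eq_hybrid, lagrangian_of_mem (by exact hy),
    lagrangian_of_mem (by exact setBlock_mem hy hu)] at h
  exact_mod_cast h

lemma IsADMM.hybrid_descent (hA : Assumptions P μf Lf μφ Lφ ρ xf zφ) (hC : IsMultiAffine P C)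
    (hI : IsADMM P C ρ x z w) {k : ℕ} (hx : x k ∈ feasSet P) (m : ℕ) (hm : m ≤ n) :
    hybrid (x (k + 1)) (x k) m ∈ feasSet P ∧
      lagR P C ρ (hybrid (x (k + 1)) (x k) m, z k, w k)
        + μf / 2 * ‖hybrid (x (k + 1)) (x k) m - x k‖ ^ 2 ≤ lagR P C ρ (x k, z k, w k) := by
  induction m with
  | zero => simp [hybrid_zero, hx]
  | succ m ih =>
    obtain ⟨h1, h2⟩ := ih (by omega)
    set i : Fin n := ⟨m, by omega⟩
    have hy : hybrid (x (k + 1)) (x k) (i.val + 1) ∈ feasSet P := hI.block_step (i := i) h1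
    refine ⟨hy, ?_⟩
    set y := hybrid (x (k + 1)) (x k) (i.val + 1) with hydef
    have hgrow := growth_of_strongConvexOn (strongConvexOn_setBlock hA hC y i (z k) (w k))
      (hy i) (hx i) (fun u hu => by
        have := hI.block_min hy hu
        rw [setBlock_self]
        simp only [lagR] at this
        linarith)
    have hyx : setBlock y i (x k i) = hybrid (x (k + 1)) (x k) m := by
      rw [hydef, ← sweep_eq_hybrid, setBlock_sweep]
    have hyi : y i = x (k + 1) i := by simp [hydef, hybrid_apply]
    have hn := norm_hybrid_succ_sq (x (k + 1)) (x k) i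
    rw [setBlock_self, hyx, hyi] at hgrow
    change lagR P C ρ (y, z k, w k) + μf / 2 * ‖y - x k‖ ^ 2 ≤ _
    rw [hydef, hn, ← hydef]
    simp only [lagR] at h2 ⊢
    linarith

lemma IsADMM.x_descent (hA : Assumptions P μf Lf μφ Lφ ρ xf zφ) (hC : IsMultiAffine P C)
    (hI : IsADMM P C ρ x z w) {k : ℕ} (hx : x k ∈ feasSet P) :
    x (k + 1) ∈ feasSet P ∧ lagR P C ρ (x (k + 1), z k, w k)
        + μf / 2 * ‖x (k + 1) - x k‖ ^ 2 ≤ lagR P C ρ (x k, z k, w k) := by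
  have := hI.hybrid_descent hA hC hx n le_rfl
  rwa [hybrid_last] at this

lemma IsADMM.mem_feasSet (hA : Assumptions P μf Lf μφ Lφ ρ xf zφ) (hC : IsMultiAffine P C)
    (hI : IsADMM P C ρ x z w) (hx : x 0 ∈ feasSet P) (k : ℕ) : x k ∈ feasSet P := by
  induction k with
  | zero => exact hx
  | succ k ih => exact (hI.x_descent hA hC ih).1

lemma IsADMM.z_min (hI : IsADMM P C ρ x z w) {k : ℕ} (hx : x (k + 1) ∈ feasSet P) (u : Vec nz) :
    lagR P C ρ (x (k + 1), z (k + 1), w k) ≤ lagR P C ρ (x (k + 1), u, w k) := by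
  have h := hI.z_step k u
  rw [lagrangian_of_mem (by exact hx), lagrangian_of_mem (by exact hx)] at h
  exact_mod_cast h

lemma IsADMM.z_descent (hA : Assumptions P μf Lf μφ Lφ ρ xf zφ) (hI : IsADMM P C ρ x z w) {k : ℕ}
    (hx : x (k + 1) ∈ feasSet P) :
    lagR P C ρ (x (k + 1), z (k + 1), w k) + μφ / 2 * ‖z (k + 1) - z k‖ ^ 2
      ≤ lagR P C ρ (x (k + 1), z k, w k) := by
  have h := growth_of_strongConvexOn (strongConvexOn_slack (C := C) hA (x (k + 1)) (w k))
    (Set.mem_univ (z (k + 1))) (Set.mem_univ (z k)) (fun u _ => by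
      have := hI.z_min hx u
      simp only [lagR] at this
      linarith)
  rw [norm_sub_rev] at h
  simp only [lagR]
  linarith

lemma fderiv_lagR_eq_zero_of_line_min (hA : Assumptions P μf Lf μφ Lφ ρ xf zφ)
    {p v : BlockVec ν × Vec nz × Vec nc}
    (h : ∀ᶠ t : ℝ in 𝓝 0, lagR P C ρ p ≤ lagR P C ρ (p + t • v)) :
    fderiv ℝ (lagR P C ρ) p v = 0 := by
  have hd := hasDerivAt_line ((contDiff_lagR hA.f_C2 hA.φ_C2 C ρ).differentiable (by norm_num))
    p v 0
  have hmin : IsLocalMin (fun t : ℝ => lagR P C ρ (p + t • v)) 0 := by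
    filter_upwards [h] with t ht
    simpa using ht
  simpa using hmin.hasDerivAt_eq_zero hd

lemma IsADMM.fderiv_z_eq_zero (hA : Assumptions P μf Lf μφ Lφ ρ xf zφ) (hI : IsADMM P C ρ x z w)
    {k : ℕ} (hx : x (k + 1) ∈ feasSet P) (b : Vec nz) :
    fderiv ℝ (lagR P C ρ) (x (k + 1), z (k + 1), w k) (0, b, 0) = 0 := by
  refine fderiv_lagR_eq_zero_of_line_min hA (Eventually.of_forall fun t => ?_)
  have := hI.z_min hx (z (k + 1) + t • b)
  simpa using this

/-- The multiplier `w` is consistent with the slack variable `z`. -/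
def DualConsistent (P : Data n ν nc nz) (z : Vec nz) (w : Vec nc) : Prop :=
  Matrix.toEuclideanLin P.Qᵀ w = -gradient P.φ z

lemma dualConsistent_iff {z : Vec nz} {w : Vec nc} :
    DualConsistent P z w ↔ ∀ b, fderiv ℝ P.φ z b + inner ℝ w (slackMap P b) = 0 := by
  have key : ∀ b, fderiv ℝ P.φ z b + inner ℝ w (slackMap P b) =
      inner ℝ (gradient P.φ z + Matrix.toEuclideanLin P.Qᵀ w) b := fun b => by
    rw [inner_add_left, inner_gradient, ← inner_toEuclideanLin]
    rfl
  constructor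
  · intro h b
    rw [key, show Matrix.toEuclideanLin P.Qᵀ w = -gradient P.φ z from h, add_neg_cancel,
      inner_zero_left]
  · intro h
    have : gradient P.φ z + Matrix.toEuclideanLin P.Qᵀ w = 0 :=
      inner_self_eq_zero.1 ((key _).symm.trans (h _))
    exact eq_neg_of_add_eq_zero_right this

/-- The optimality condition of the slack update contains `w k + ρ • residual`, which is exactly the
new multiplier. -/
lemma IsADMM.dualConsistent (hA : Assumptions P μf Lf μφ Lφ ρ xf zφ) (hI : IsADMM P C ρ x z w)
    {k : ℕ} (hx : x (k + 1) ∈ feasSet P) : DualConsistent P (z (k + 1)) (w (k + 1)) := by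
  rw [dualConsistent_iff]
  intro b
  have h := hI.fderiv_z_eq_zero hA hx b
  rw [fderiv_lagR_apply hA.f_C2 hA.φ_C2] at h
  rw [hI.w_step k]
  simpa using h

lemma lagR_add_smul_residual (x : BlockVec ν) (z : Vec nz) (w : Vec nc) :
    lagR P C ρ (x, z, w + ρ • residual P C x z) =
      lagR P C ρ (x, z, w) + ρ * ‖residual P C x z‖ ^ 2 := by
  simp only [lagR, inner_add_left, inner_smul_left, conj_trivial, real_inner_self_eq_norm_sq]
  ring

lemma four_mul_sq_le (hA : Assumptions P μf Lf μφ Lφ ρ xf zφ) (hnc : 0 < nc) :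
    4 * Lφ ^ 2 ≤ ρ * μφ * lamMin (P.Q * P.Qᵀ) := by
  obtain ⟨h1, h2⟩ := lamMinPos_transpose_mul hA.Q_rank hnc
  have h3 := (le_max_left _ _).trans hA.ρ_ge
  have hμ := hA.μφ_pos
  have hρ := hA.ρ_pos
  rw [div_le_iff₀ (by positivity)] at h3
  calc _ ≤ _ := h3
    _ ≤ ρ * (μφ * lamMin (P.Q * P.Qᵀ)) := by gcongr
    _ = _ := by ring

/-- Consistency turns `Qᵀ (w' - w)` into a difference of gradients of `φ`, which is Lipschitz, while
`Qᵀ` is bounded below by the square root of `lamMin`. -/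
lemma norm_dual_step_sq_le (hA : Assumptions P μf Lf μφ Lφ ρ xf zφ) (hnc : 0 < nc)
    {z z' : Vec nz} {w w' : Vec nc} (h : DualConsistent P z w) (h' : DualConsistent P z' w') :
    ‖w' - w‖ ^ 2 ≤ ρ * μφ / 4 * ‖z' - z‖ ^ 2 := by
  have h1 := lamMin_le_norm_transpose_sq hA.Q_rank (w' - w)
  have h2 : ‖Matrix.toEuclideanLin P.Qᵀ (w' - w)‖ ≤ Lφ * ‖z' - z‖ := by
    rw [map_sub, show Matrix.toEuclideanLin P.Qᵀ w = _ from h,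
      show Matrix.toEuclideanLin P.Qᵀ w' = _ from h', ← norm_neg, neg_sub_neg, neg_sub]
    exact hA.φ_smooth.2 z' z
  have h3 : ‖Matrix.toEuclideanLin P.Qᵀ (w' - w)‖ ^ 2 ≤ (Lφ * ‖z' - z‖) ^ 2 := by gcongr
  have h4 := mul_le_mul_of_nonneg_right (four_mul_sq_le hA hnc) (sq_nonneg ‖z' - z‖)
  have hl := lamMin_pos hA.Q_rank hnc
  refine le_of_mul_le_mul_left ?_ hl
  rw [mul_pow] at h3
  linarith

/-- The dual update raises the Lagrangian by `ρ ‖residual‖² = ‖w (k + 1) - w k‖² / ρ`, at most half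
of the gain `μφ / 2 * ‖z (k + 1) - z k‖ ^ 2` of the slack update. -/
lemma IsADMM.descent (hA : Assumptions P μf Lf μφ Lφ ρ xf zφ) (hC : IsMultiAffine P C)
    (hI : IsADMM P C ρ x z w) (hnc : 0 < nc) {k : ℕ} (hx : x k ∈ feasSet P)
    (hk : DualConsistent P (z k) (w k)) :
    lagR P C ρ (x (k + 1), z (k + 1), w (k + 1)) + μf / 2 * ‖x (k + 1) - x k‖ ^ 2
      + μφ / 4 * ‖z (k + 1) - z k‖ ^ 2 ≤ lagR P C ρ (x k, z k, w k) := by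
  obtain ⟨hx1, h1⟩ := hI.x_descent hA hC hx
  have h2 := hI.z_descent hA hx1
  have h3 := norm_dual_step_sq_le hA hnc hk (hI.dualConsistent hA hx1)
  have hρ := hA.ρ_pos
  rw [hI.w_step k, lagR_add_smul_residual]
  rw [hI.w_step k, add_sub_cancel_left, norm_smul, Real.norm_of_nonneg hρ.le, mul_pow] at h3
  have h4 : ρ * ‖residual P C (x (k + 1)) (z (k + 1))‖ ^ 2 ≤ μφ / 4 * ‖z (k + 1) - z k‖ ^ 2 := by
    refine le_of_mul_le_mul_left ?_ hρ
    linarith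
  linarith

lemma IsADMM.step_sq_le (hA : Assumptions P μf Lf μφ Lφ ρ xf zφ) (hC : IsMultiAffine P C)
    (hI : IsADMM P C ρ x z w) (hnc : 0 < nc) {k : ℕ} (hx : x k ∈ feasSet P)
    (hk : DualConsistent P (z k) (w k)) :
    ‖((x (k + 1), z (k + 1), w (k + 1)) : BlockVec ν × Vec nz × Vec nc) - (x k, z k, w k)‖ ^ 2 ≤
      (2 / μf + 4 / μφ + ρ) * (lagR P C ρ (x k, z k, w k)
        - lagR P C ρ (x (k + 1), z (k + 1), w (k + 1))) := by
  have h1 := hI.descent hA hC hnc hx hk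
  have h2 := norm_dual_step_sq_le hA hnc hk (hI.dualConsistent hA (hI.x_descent hA hC hx).1)
  set D := lagR P C ρ (x k, z k, w k) - lagR P C ρ (x (k + 1), z (k + 1), w (k + 1)) with hD
  have hμf := hA.μf_pos
  have hμφ := hA.μφ_pos
  have hρ := hA.ρ_pos
  have ha : 0 ≤ μf / 2 * ‖x (k + 1) - x k‖ ^ 2 := by positivity
  have hb : 0 ≤ μφ / 4 * ‖z (k + 1) - z k‖ ^ 2 := by positivity
  have hD0 : 0 ≤ D := by linarith
  have e1 : ‖x (k + 1) - x k‖ ^ 2 ≤ 2 / μf * D := by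
    rw [div_mul_eq_mul_div, le_div_iff₀ hμf]; linarith
  have e2 : ‖z (k + 1) - z k‖ ^ 2 ≤ 4 / μφ * D := by
    rw [div_mul_eq_mul_div, le_div_iff₀ hμφ]; linarith
  have e3 : ‖w (k + 1) - w k‖ ^ 2 ≤ ρ * D := by
    have : ρ * (μφ / 4 * ‖z (k + 1) - z k‖ ^ 2) ≤ ρ * D := by gcongr; linarith
    linarith
  have p1 : 0 ≤ 2 / μf * D := by positivity
  have p2 : 0 ≤ 4 / μφ * D := by positivity
  have p3 : 0 ≤ ρ * D := by positivity
  -- The product carries the sup norm, so each component is bounded separately.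
  have hnn : ‖((x (k + 1), z (k + 1), w (k + 1)) : BlockVec ν × Vec nz × Vec nc) - (x k, z k, w k)‖
      = max ‖x (k + 1) - x k‖ (max ‖z (k + 1) - z k‖ ‖w (k + 1) - w k‖) := rfl
  rw [hnn, add_mul, add_mul]
  rcases max_choice ‖x (k + 1) - x k‖ (max ‖z (k + 1) - z k‖ ‖w (k + 1) - w k‖) with h | h
  · rw [h]; linarith
  · rw [h]
    rcases max_choice ‖z (k + 1) - z k‖ ‖w (k + 1) - w k‖ with h | h <;> rw [h] <;> linarith

/-- By consistency `⟨w, r⟩` equals minus the derivative of `φ` at `z` along `rightInv P.Q r`, so `φ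
z + ⟨w, r⟩` is the linearisation of `φ` at the shifted slack. The penalty absorbs the quadratic
error, since `Lφ ≤ ρ * lamMin (P.Q * P.Qᵀ)`. -/
lemma lagR_lower (hA : Assumptions P μf Lf μφ Lφ ρ xf zφ) (hnc : 0 < nc)
    (x : BlockVec ν) {z : Vec nz} {w : Vec nc} (h : DualConsistent P z w) :
    P.f x + P.φ (z - rightInv P.Q (residual P C x z)) ≤ lagR P C ρ (x, z, w) := by
  set r := residual P C x z with hr
  have h1 := smooth_upper (hA.φ_C2.differentiable (by norm_num))
    (fun u v => hA.φ_smooth.fderiv_lipschitz u v) z (z - rightInv P.Q r)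
  rw [sub_sub_cancel_left, map_neg, norm_neg] at h1
  have h2 := dualConsistent_iff.1 h (rightInv P.Q r)
  rw [show slackMap P (rightInv P.Q r) = r from apply_rightInv hA.Q_rank r] at h2
  have h3 := norm_rightInv_sq_le hA.Q_rank hnc r
  have hl := lamMin_pos hA.Q_rank hnc
  have h4 := four_mul_sq_le hA hnc
  have : Nontrivial (Vec nz) := nontrivial_of_rank hA.Q_rank hnc
  have h5 := modulus_le_smoothness hA.φ_strong (hA.φ_C2.differentiable (by norm_num)) hA.φ_smooth
  have hμ := hA.μφ_pos
  have hLφ := hA.φ_smooth.1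
  have hρ := hA.ρ_pos
  have h6 : Lφ ≤ ρ * lamMin (P.Q * P.Qᵀ) := by
    refine le_of_mul_le_mul_left ?_ hμ
    nlinarith
  have h7 : Lφ * ‖rightInv P.Q r‖ ^ 2 ≤ ρ * ‖r‖ ^ 2 := by
    calc _ ≤ ρ * lamMin (P.Q * P.Qᵀ) * ‖rightInv P.Q r‖ ^ 2 := by gcongr
      _ = ρ * (lamMin (P.Q * P.Qᵀ) * ‖rightInv P.Q r‖ ^ 2) := by ring
      _ ≤ _ := by gcongr
  simp only [lagR, ← hr]
  linarith

end Iterates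

/-! ### Limit points: existence, stationarity, nondegeneracy and local optimality -/

section LimitPoints

variable {n : ℕ} {ν : Fin n → ℕ} {nc nz : ℕ} {P : Data n ν nc nz} {C : QuadPart ν nc}
  {μf Lf μφ Lφ ρ : ℝ} {xf : BlockVec ν} {zφ : Vec nz}
  {x : ℕ → BlockVec ν} {z : ℕ → Vec nz} {w : ℕ → Vec nc}

lemma f_growth (hA : Assumptions P μf Lf μφ Lφ ρ xf zφ) (x : BlockVec ν) :
    P.f xf + μf / 2 * ‖x - xf‖ ^ 2 ≤ P.f x :=
  growth_of_strongConvexOn hA.f_strong (Set.mem_univ _) (Set.mem_univ _)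
    fun u _ => hA.f_min (Set.mem_univ u)

lemma φ_growth (hA : Assumptions P μf Lf μφ Lφ ρ xf zφ) (z : Vec nz) :
    P.φ zφ + μφ / 2 * ‖z - zφ‖ ^ 2 ≤ P.φ z :=
  growth_of_strongConvexOn hA.φ_strong (Set.mem_univ _) (Set.mem_univ _)
    fun u _ => hA.φ_min (Set.mem_univ u)

lemma min_le_lagR (hA : Assumptions P μf Lf μφ Lφ ρ xf zφ) (hnc : 0 < nc)
    (x : BlockVec ν) {z : Vec nz} {w : Vec nc} (h : DualConsistent P z w) :
    P.f xf + P.φ zφ ≤ lagR P C ρ (x, z, w) :=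
  (add_le_add (hA.f_min (Set.mem_univ _)) (hA.φ_min (Set.mem_univ _))).trans
    (lagR_lower hA hnc x h)

lemma norm_dual_le (hA : Assumptions P μf Lf μφ Lφ ρ xf zφ) {z : Vec nz} {w : Vec nc}
    (h : DualConsistent P z w) :
    ‖w‖ ≤ ‖(P.Q * P.Qᵀ)⁻¹ * P.Q‖ * (Lφ * ‖z - zφ‖) := by
  refine (norm_le_norm_transpose hA.Q_rank w).trans ?_
  have h0 : gradient P.φ zφ = 0 := by
    rw [gradient, fderiv_eq_zero_of_isMinOn hA.φ_min, map_zero]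
  have h1 := hA.φ_smooth.2 z zφ
  rw [h0, sub_zero] at h1
  rw [show Matrix.toEuclideanLin P.Qᵀ w = _ from h, norm_neg]
  gcongr

lemma IsADMM.lagR_succ_le (hA : Assumptions P μf Lf μφ Lφ ρ xf zφ) (hC : IsMultiAffine P C)
    (hI : IsADMM P C ρ x z w) (hnc : 0 < nc) {k : ℕ} (hx : x k ∈ feasSet P)
    (hk : DualConsistent P (z k) (w k)) :
    lagR P C ρ (x (k + 1), z (k + 1), w (k + 1)) ≤ lagR P C ρ (x k, z k, w k) := by
  have h := hI.descent hA hC hnc hx hk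
  have hμf := hA.μf_pos
  have hμφ := hA.μφ_pos
  have ha : 0 ≤ μf / 2 * ‖x (k + 1) - x k‖ ^ 2 := by positivity
  have hb : 0 ≤ μφ / 4 * ‖z (k + 1) - z k‖ ^ 2 := by positivity
  linarith

/-- The sequence of iterates `(x^k, z^k, w^k)`. -/
def iterates (x : ℕ → BlockVec ν) (z : ℕ → Vec nz) (w : ℕ → Vec nc) (k : ℕ) :
    BlockVec ν × Vec nz × Vec nc := (x k, z k, w k)

lemma IsADMM.dualConsistent_of_one_le (hA : Assumptions P μf Lf μφ Lφ ρ xf zφ)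
    (hC : IsMultiAffine P C) (hI : IsADMM P C ρ x z w) (hx : x 0 ∈ feasSet P)
    {k : ℕ} (hk : 1 ≤ k) : DualConsistent P (z k) (w k) := by
  obtain ⟨j, rfl⟩ : ∃ j, k = j + 1 := ⟨k - 1, by omega⟩
  exact hI.dualConsistent hA (hI.mem_feasSet hA hC hx (j + 1))

lemma IsADMM.tendsto_step (hA : Assumptions P μf Lf μφ Lφ ρ xf zφ) (hC : IsMultiAffine P C)
    (hI : IsADMM P C ρ x z w) (hnc : 0 < nc) (hx : x 0 ∈ feasSet P) :
    Tendsto (fun k => ‖iterates x z w (k + 1) - iterates x z w k‖) atTop (𝓝 0) :=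
  tendsto_step_zero (g := lagR P C ρ)
    (fun k hk => hI.step_sq_le hA hC hnc (hI.mem_feasSet hA hC hx k)
      (hI.dualConsistent_of_one_le hA hC hx hk))
    (fun k hk => hI.lagR_succ_le hA hC hnc (hI.mem_feasSet hA hC hx k)
      (hI.dualConsistent_of_one_le hA hC hx hk))
    (fun k hk => min_le_lagR hA hnc (x k) (hI.dualConsistent_of_one_le hA hC hx hk))

lemma IsADMM.lagR_le_one (hA : Assumptions P μf Lf μφ Lφ ρ xf zφ) (hC : IsMultiAffine P C)
    (hI : IsADMM P C ρ x z w) (hnc : 0 < nc) (hx : x 0 ∈ feasSet P) {k : ℕ} (hk : 1 ≤ k) :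
    lagR P C ρ (x k, z k, w k) ≤ lagR P C ρ (x 1, z 1, w 1) := by
  induction k, hk using Nat.le_induction with
  | base => exact le_rfl
  | succ k hk ih => exact (hI.lagR_succ_le hA hC hnc (hI.mem_feasSet hA hC hx k)
      (hI.dualConsistent_of_one_le hA hC hx hk)).trans ih

lemma norm_le_add_sqrt {E : Type*} [NormedAddCommGroup E] {u v : E} {m D : ℝ} (hm : 0 < m)
    (h : m / 2 * ‖u - v‖ ^ 2 ≤ D) : ‖u‖ ≤ ‖v‖ + √(2 * D / m) := by
  have h1 : ‖u - v‖ ≤ √(2 * D / m) := by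
    refine Real.le_sqrt_of_sq_le ?_
    rw [le_div_iff₀ hm]
    linarith
  have := norm_le_norm_add_norm_sub' u v
  linarith

lemma IsADMM.norm_residual_le (hA : Assumptions P μf Lf μφ Lφ ρ xf zφ)
    (hI : IsADMM P C ρ x z w) (k : ℕ) : ‖residual P C (x (k + 1)) (z (k + 1))‖
      ≤ ρ⁻¹ * ‖iterates x z w (k + 1) - iterates x z w k‖ := by
  have hρ := hA.ρ_pos
  have h1 : ρ * ‖residual P C (x (k + 1)) (z (k + 1))‖ = ‖w (k + 1) - w k‖ := by
    rw [hI.w_step k, add_sub_cancel_left, norm_smul, Real.norm_of_nonneg hρ.le]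
  have h2 : ‖w (k + 1) - w k‖ ≤ ‖iterates x z w (k + 1) - iterates x z w k‖ :=
    (norm_snd_le (iterates x z w (k + 1) - iterates x z w k).2).trans (norm_snd_le _)
  rw [le_inv_mul_iff₀ hρ, h1]
  exact h2

/-- Descent and `lagR_lower` bound `x` and the shifted slack. The residual tends to zero, which
bounds `z`, and consistency then bounds `w`. -/
lemma IsADMM.exists_mapClusterPt (hA : Assumptions P μf Lf μφ Lφ ρ xf zφ)
    (hC : IsMultiAffine P C) (hI : IsADMM P C ρ x z w) (hnc : 0 < nc) (hx : x 0 ∈ feasSet P) :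
    ∃ p, MapClusterPt p atTop (iterates x z w) := by
  have hρ := hA.ρ_pos
  set D := lagR P C ρ (x 1, z 1, w 1) - P.f xf - P.φ zφ with hD
  set a := ‖xf‖ + √(2 * D / μf)
  set b := ‖zφ‖ + √(2 * D / μφ) + ‖P.Qᵀ * (P.Q * P.Qᵀ)⁻¹‖ * 1 with hb
  set c := ‖(P.Q * P.Qᵀ)⁻¹ * P.Q‖ * (Lφ * (b + ‖zφ‖))
  have hev : ∀ᶠ k in atTop, iterates x z w k ∈
      Metric.closedBall (0 : BlockVec ν × Vec nz × Vec nc) (max a (max b c)) := by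
    rw [← map_add_atTop_eq_nat 1, eventually_map]
    filter_upwards [(hI.tendsto_step hA hC hnc hx).eventually (ge_mem_nhds hρ)] with k hk
    have hdc : DualConsistent P (z (k + 1)) (w (k + 1)) :=
      hI.dualConsistent_of_one_le hA hC hx (by omega)
    have hr : ‖residual P C (x (k + 1)) (z (k + 1))‖ ≤ 1 := by
      refine (hI.norm_residual_le hA k).trans ?_
      rw [inv_mul_le_iff₀ hρ, mul_one]
      exact hk
    have hl := (lagR_lower hA hnc (C := C) (x (k + 1)) hdc).trans
      (hI.lagR_le_one hA hC hnc hx (by omega))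
    set z' := z (k + 1) - rightInv P.Q (residual P C (x (k + 1)) (z (k + 1))) with hz'
    have hf := f_growth hA (x (k + 1))
    have hφ := φ_growth hA z'
    have p1 : 0 ≤ μf / 2 * ‖x (k + 1) - xf‖ ^ 2 := by have := hA.μf_pos; positivity
    have p2 : 0 ≤ μφ / 2 * ‖z' - zφ‖ ^ 2 := by have := hA.μφ_pos; positivity
    have hxa : ‖x (k + 1)‖ ≤ a := norm_le_add_sqrt hA.μf_pos (by linarith)
    have hz'b : ‖z'‖ ≤ ‖zφ‖ + √(2 * D / μφ) := norm_le_add_sqrt hA.μφ_pos (by linarith)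
    have hzb : ‖z (k + 1)‖ ≤ b := by
      have h1 : ‖rightInv P.Q (residual P C (x (k + 1)) (z (k + 1)))‖
          ≤ ‖P.Qᵀ * (P.Q * P.Qᵀ)⁻¹‖ * 1 :=
        (norm_toEuclideanLin_le _ _).trans (by gcongr)
      have h2 : z (k + 1) = z' + rightInv P.Q (residual P C (x (k + 1)) (z (k + 1))) := by
        rw [hz', sub_add_cancel]
      rw [h2]
      exact (norm_add_le _ _).trans (add_le_add hz'b h1)
    have hwc : ‖w (k + 1)‖ ≤ c := by
      refine (norm_dual_le hA hdc).trans ?_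
      have h3 := norm_sub_le (z (k + 1)) zφ
      exact mul_le_mul_of_nonneg_left
        (mul_le_mul_of_nonneg_left (by linarith) hA.φ_smooth.1.le) (norm_nonneg _)
    rw [mem_closedBall_zero_iff]
    exact max_le_max hxa (max_le_max hzb hwc)
  obtain ⟨p, -, hp⟩ := (isCompact_closedBall _ _).exists_mapClusterPt_of_frequently hev.frequently
  exact ⟨p, hp⟩

lemma IsADMM.fderiv_block_eq_zero (hA : Assumptions P μf Lf μφ Lφ ρ xf zφ)
    (hI : IsADMM P C ρ x z w) {k : ℕ} {i : Fin n}
    (hmem : ∀ᶠ y in 𝓝 (hybrid (x (k + 1)) (x k) (i.val + 1)), y ∈ feasSet P) (h : Vec (ν i)) :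
    fderiv ℝ (lagR P C ρ) (hybrid (x (k + 1)) (x k) (i.val + 1), z k, w k)
      (PiLp.single 2 i h, 0, 0) = 0 := by
  set y := hybrid (x (k + 1)) (x k) (i.val + 1) with hy
  refine fderiv_lagR_eq_zero_of_line_min hA ?_
  have hcont : Tendsto (fun t : ℝ => y + t • (PiLp.single 2 i h : BlockVec ν)) (𝓝 0) (𝓝 y) := by
    have : Continuous fun t : ℝ => y + t • (PiLp.single 2 i h : BlockVec ν) := by fun_prop
    simpa using this.tendsto 0
  filter_upwards [hcont.eventually hmem] with t ht
  have h1 : t • (PiLp.single 2 i h : BlockVec ν) = PiLp.single 2 i (t • h) := by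
    refine blockVec_ext fun j => ?_
    by_cases hj : j = i
    · subst hj; simp
    · simp [hj]
  rw [h1, ← setBlock_eq_add_single] at ht
  have h2 := ht i
  rw [setBlock_same] at h2
  have h3 := hI.block_min hmem.self_of_nhds h2
  rw [← hy, setBlock_eq_add_single, ← h1] at h3
  simpa using h3

lemma sum_single (a : BlockVec ν) : ∑ i, (PiLp.single 2 i (a i) : BlockVec ν) = a := by
  refine blockVec_ext fun j => ?_
  rw [WithLp.ofLp_sum, Finset.sum_apply, Finset.sum_eq_single j]
  · simp
  · intro i _ hij
    exact PiLp.single_eq_of_ne' 2 hij _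
  · simp

/-- Each block derivative and the slack derivative vanish at some intermediate point of the
iteration, no farther from the new iterate than the last step; the Lipschitz bound transfers this.
The dual derivative is the residual, a dual step divided by `ρ`. Radius `ε / 3` keeps the
intermediate points in the `ε`-ball. -/
lemma IsADMM.norm_fderiv_le (hA : Assumptions P μf Lf μφ Lφ ρ xf zφ)
    (hI : IsADMM P C ρ x z w) {ps : BlockVec ν × Vec nz × Vec nc} {ε K : ℝ} (hK0 : 0 ≤ K)
    (hfeas : ∀ q ∈ Metric.ball ps ε, q.1 ∈ feasSet P)
    (hK : ∀ q ∈ Metric.ball ps ε, ∀ q' ∈ Metric.ball ps ε,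
      ‖fderiv ℝ (lagR P C ρ) q - fderiv ℝ (lagR P C ρ) q'‖ ≤ K * ‖q - q'‖) {k : ℕ}
    (hk : iterates x z w k ∈ Metric.ball ps (ε / 3))
    (hk1 : iterates x z w (k + 1) ∈ Metric.ball ps (ε / 3)) :
    ‖fderiv ℝ (lagR P C ρ) (iterates x z w (k + 1))‖ ≤
      ((n + 1) * K + ρ⁻¹) * ‖iterates x z w (k + 1) - iterates x z w k‖ := by
  set p := iterates x z w k with hp
  set p' := iterates x z w (k + 1) with hp'
  set δ := ‖p' - p‖ with hδ
  have hρ := hA.ρ_pos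
  have hε : 0 < ε := by
    have := dist_nonneg.trans_lt (Metric.mem_ball.1 hk)
    linarith
  have hδε : δ < 2 * (ε / 3) := by
    rw [mem_ball_iff_norm] at hk hk1
    have := norm_sub_le (p' - ps) (p - ps)
    rw [sub_sub_sub_cancel_right] at this
    linarith
  have hdx : ‖x (k + 1) - x k‖ ≤ δ := norm_fst_le (p' - p)
  have hdz : ‖z (k + 1) - z k‖ ≤ δ := (norm_fst_le (p' - p).2).trans (norm_snd_le (p' - p))
  have hdw : ‖w (k + 1) - w k‖ ≤ δ := (norm_snd_le (p' - p).2).trans (norm_snd_le (p' - p))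
  have hp'ball : p' ∈ Metric.ball ps ε := Metric.ball_subset_ball (by linarith) hk1
  have hnear : ∀ q : BlockVec ν × Vec nz × Vec nc, ‖p' - q‖ ≤ δ → q ∈ Metric.ball ps ε := by
    intro q hq
    rw [mem_ball_iff_norm] at hk1 ⊢
    have := norm_sub_le (p' - ps) (p' - q)
    rw [sub_sub_sub_cancel_left] at this
    linarith
  have hblock : ∀ (i : Fin n) (h : Vec (ν i)),
      |fderiv ℝ (lagR P C ρ) p' (PiLp.single 2 i h, 0, 0)| ≤ K * δ * ‖h‖ := by
    intro i h
    set q : BlockVec ν × Vec nz × Vec nc :=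
      (hybrid (x (k + 1)) (x k) (i.val + 1), z k, w k) with hq
    have hqd : ‖p' - q‖ ≤ δ :=
      max_le ((norm_sub_hybrid_le _ _ _).trans hdx) (max_le hdz hdw)
    have hqb := hnear q hqd
    have h0 : fderiv ℝ (lagR P C ρ) q (PiLp.single 2 i h, 0, 0) = 0 := by
      refine hI.fderiv_block_eq_zero hA ?_ h
      have hc : Tendsto (fun y : BlockVec ν => (y, z k, w k)) (𝓝 q.1) (𝓝 q) :=
        Continuous.tendsto (by fun_prop) q.1
      filter_upwards [hc.eventually (Metric.isOpen_ball.mem_nhds hqb)] with y hy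
      exact hfeas _ hy
    have h1 := (fderiv ℝ (lagR P C ρ) p' - fderiv ℝ (lagR P C ρ) q).le_opNorm
      (PiLp.single 2 i h, 0, 0)
    rw [sub_apply, h0, sub_zero, Real.norm_eq_abs] at h1
    have h2 : ‖((PiLp.single 2 i h, 0, 0) : BlockVec ν × Vec nz × Vec nc)‖ = ‖h‖ := by
      simp [Prod.norm_def]
    rw [h2] at h1
    refine h1.trans ?_
    have h3 := (hK p' hp'ball q hqb).trans (mul_le_mul_of_nonneg_left hqd hK0)
    gcongr
  have hz : ∀ b : Vec nz, |fderiv ℝ (lagR P C ρ) p' (0, b, 0)| ≤ K * δ * ‖b‖ := by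
    intro b
    set q : BlockVec ν × Vec nz × Vec nc := (x (k + 1), z (k + 1), w k) with hq
    have hqd : ‖p' - q‖ ≤ δ := by
      refine max_le ?_ (max_le ?_ hdw)
      · simp only [hp', hq, iterates, Prod.fst_sub, sub_self, norm_zero, hδ]; positivity
      · simp only [hp', hq, iterates, Prod.fst_sub, Prod.snd_sub, sub_self, norm_zero, hδ]
        positivity
    have h0 : fderiv ℝ (lagR P C ρ) q (0, b, 0) = 0 :=
      hI.fderiv_z_eq_zero hA (hfeas _ hp'ball) b
    have h1 := (fderiv ℝ (lagR P C ρ) p' - fderiv ℝ (lagR P C ρ) q).le_opNorm (0, b, 0)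
    rw [sub_apply, h0, sub_zero, Real.norm_eq_abs] at h1
    have h2 : ‖((0, b, 0) : BlockVec ν × Vec nz × Vec nc)‖ = ‖b‖ := by
      simp [Prod.norm_def]
    rw [h2] at h1
    refine h1.trans ?_
    have h3 := (hK p' hp'ball q (hnear q hqd)).trans (mul_le_mul_of_nonneg_left hqd hK0)
    gcongr
  have hw : ∀ c : Vec nc, |fderiv ℝ (lagR P C ρ) p' (0, 0, c)| ≤ ρ⁻¹ * δ * ‖c‖ := by
    intro c
    have h1 := fderiv_lagR_apply hA.f_C2 hA.φ_C2 C ρ p' (0, 0, c)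
    simp only [map_zero, add_zero, zero_add, inner_zero_right] at h1
    rw [h1, mul_comm _ ‖c‖]
    exact (abs_real_inner_le_norm _ _).trans
      (mul_le_mul_of_nonneg_left (hI.norm_residual_le hA k) (norm_nonneg _))
  refine ContinuousLinearMap.opNorm_le_bound _ (by positivity) fun v => ?_
  obtain ⟨a, b, c⟩ := v
  have hv : ((a, b, c) : BlockVec ν × Vec nz × Vec nc) =
      ∑ i, ((PiLp.single 2 i (a i), 0, 0) : BlockVec ν × Vec nz × Vec nc)
        + (0, b, 0) + (0, 0, c) := by
    have : ∑ i, ((PiLp.single 2 i (a i), 0, 0) : BlockVec ν × Vec nz × Vec nc) = (a, 0, 0) := by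
      refine Prod.ext ?_ (Prod.ext ?_ ?_)
      · rw [Prod.fst_sum]; exact sum_single a
      · simp [Prod.snd_sum]
      · simp [Prod.snd_sum]
    rw [this]; simp
  have ha : ‖a‖ ≤ ‖((a, b, c) : BlockVec ν × Vec nz × Vec nc)‖ := norm_fst_le (a, b, c)
  have hb : ‖b‖ ≤ ‖((a, b, c) : BlockVec ν × Vec nz × Vec nc)‖ :=
    (norm_fst_le (b, c)).trans (norm_snd_le (a, b, c))
  have hc : ‖c‖ ≤ ‖((a, b, c) : BlockVec ν × Vec nz × Vec nc)‖ :=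
    (norm_snd_le (b, c)).trans (norm_snd_le (a, b, c))
  set N := ‖((a, b, c) : BlockVec ν × Vec nz × Vec nc)‖
  rw [hv, map_add, map_add, map_sum, Real.norm_eq_abs]
  have hKδ : 0 ≤ K * δ := by positivity
  have hρδ : 0 ≤ ρ⁻¹ * δ := by positivity
  have hsum : |∑ i, fderiv ℝ (lagR P C ρ) p' (PiLp.single 2 i (a i), 0, 0)| ≤ n * (K * δ * N) := by
    refine (Finset.abs_sum_le_sum_abs _ _).trans ?_
    refine (Finset.sum_le_sum (g := fun _ => K * δ * N) fun i _ => ?_).trans_eq (by simp)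
    exact (hblock i (a i)).trans
      (mul_le_mul_of_nonneg_left ((PiLp.norm_apply_le a i).trans ha) hKδ)
  refine (abs_add_three _ _ _).trans ?_
  have h2 := (hz b).trans (mul_le_mul_of_nonneg_left hb hKδ)
  have h3 := (hw c).trans (mul_le_mul_of_nonneg_left hc hρδ)
  calc _ ≤ n * (K * δ * N) + K * δ * N + ρ⁻¹ * δ * N := by gcongr
    _ = _ := by ring

lemma fderiv_eq_zero_of_mapClusterPt (hA : Assumptions P μf Lf μφ Lφ ρ xf zφ)
    {ps : BlockVec ν × Vec nz × Vec nc} {ε c : ℝ} (hε : 0 < ε)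
    (hps : MapClusterPt ps atTop (iterates x z w))
    (hstep : Tendsto (fun k => ‖iterates x z w (k + 1) - iterates x z w k‖) atTop (𝓝 0))
    (hgrad : ∀ k, iterates x z w k ∈ Metric.ball ps ε → iterates x z w (k + 1) ∈ Metric.ball ps ε →
      ‖fderiv ℝ (lagR P C ρ) (iterates x z w (k + 1))‖ ≤
        c * ‖iterates x z w (k + 1) - iterates x z w k‖) :
    fderiv ℝ (lagR P C ρ) ps = 0 := by
  obtain ⟨ψ, hψ, hlim⟩ := hps.tendsto_subseq
  have hs := hstep.comp hψ.tendsto_atTop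
  have hlim' : Tendsto (fun j => iterates x z w (ψ j + 1)) atTop (𝓝 ps) := by
    have h1 := (tendsto_zero_iff_norm_tendsto_zero.2 hs).add hlim
    simpa using h1
  have hcont : Continuous (fderiv ℝ (lagR P C ρ)) :=
    (contDiff_lagR hA.f_C2 hA.φ_C2 C ρ).continuous_fderiv (by norm_num)
  have hlim2 := ((hcont.tendsto ps).comp hlim').norm
  have h0 : Tendsto (fun j => ‖fderiv ℝ (lagR P C ρ) (iterates x z w (ψ j + 1))‖) atTop (𝓝 0) := by
    refine tendsto_of_tendsto_of_tendsto_of_le_of_le' tendsto_const_nhds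
      (by simpa using hs.const_mul c) (Eventually.of_forall fun _ => norm_nonneg _) ?_
    filter_upwards [hlim.eventually (Metric.ball_mem_nhds ps hε),
      hlim'.eventually (Metric.ball_mem_nhds ps hε)] with j h1 h2
    exact hgrad _ h1 h2
  exact norm_eq_zero.1 (tendsto_nhds_unique hlim2 h0)

lemma lagrangian_toReal_eventuallyEq {ps : BlockVec ν × Vec nz × Vec nc} {ε : ℝ} (hε : 0 < ε)
    (hfeas : ∀ q ∈ Metric.ball ps ε, q.1 ∈ feasSet P) :
    (fun q => (lagrangian P C ρ q).toReal) =ᶠ[𝓝 ps] lagR P C ρ := by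
  filter_upwards [Metric.ball_mem_nhds ps hε] with q hq
  rw [lagrangian_of_mem (hfeas q hq), EReal.toReal_coe]

/-- A stationary point of the smooth augmented Lagrangian is feasible, and its multiplier satisfies
the first-order conditions. -/
lemma kkt_of_stationary (hA : Assumptions P μf Lf μφ Lφ ρ xf zφ)
    {xs : BlockVec ν} {zs : Vec nz} {ws : Vec nc}
    (h : fderiv ℝ (lagR P C ρ) (xs, zs, ws) = 0) :
    residual P C xs zs = 0 ∧ (∀ a, fderiv ℝ P.f xs a + inner ℝ ws (jac P C xs a) = 0) ∧
      DualConsistent P zs ws := by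
  have key := fun v => fderiv_lagR_apply hA.f_C2 hA.φ_C2 C ρ (xs, zs, ws) v
  simp only [h, zero_apply] at key
  have hr : residual P C xs zs = 0 := by
    have := key (0, 0, residual P C xs zs)
    simpa using this.symm
  refine ⟨hr, fun a => ?_, dualConsistent_iff.2 fun b => ?_⟩
  · have := key (a, 0, 0)
    simpa [hr] using this.symm
  · have := key (0, b, 0)
    simpa [hr] using this.symm

lemma abs_inner_bilin_le (w : Vec nc) (a : BlockVec ν) :
    |inner ℝ w (bilin C a a)| ≤ √nc * normC C * ‖w‖ * ‖a‖ ^ 2 :=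
  calc _ ≤ ‖w‖ * ‖bilin C a a‖ := abs_real_inner_le_norm _ _
    _ ≤ ‖w‖ * (√nc * (normC C * ‖a‖ ^ 2)) := by gcongr; exact norm_bilin_self_le C a
    _ = _ := by ring

/-- Dual test directions force `(a, b)` to be tangent to the constraint. Testing with `(a, b, 0)`
then leaves the Hessians of `f` and `φ` plus a curvature term too small to cancel them, so `a = b =
0`; surjectivity of `Q` finally removes `c`. -/
lemma hessian_lagR_nondegenerate (hA : Assumptions P μf Lf μφ Lφ ρ xf zφ)
    {xs : BlockVec ν} {zs : Vec nz} {ws : Vec nc} (hr : residual P C xs zs = 0)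
    (hsmall : √nc * normC C * ‖ws‖ < μf) (u : BlockVec ν × Vec nz × Vec nc)
    (hu : ∀ v, fderiv ℝ (fderiv ℝ (lagR P C ρ)) (xs, zs, ws) u v = 0) : u = 0 := by
  obtain ⟨a, b, c⟩ := u
  have key := fun v => (hessian_lagR_apply hA.f_C2 hA.φ_C2 C ρ (xs, zs, ws) (a, b, c) v).symm.trans
    (hu v)
  simp only [hr, smul_zero, add_zero] at key
  have hJ : jac P C xs a + slackMap P b = 0 := by
    have := key (0, 0, jac P C xs a + slackMap P b)
    simpa using this
  have h1 := key (a, b, 0)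
  simp only [hJ, inner_zero_right, add_zero] at h1
  have hf := hessian_lower hA.f_strong hA.f_C2 xs a
  have hφ := hessian_lower hA.φ_strong hA.φ_C2 zs b
  have hb := (abs_le.1 (abs_inner_bilin_le (C := C) ws a)).1
  have hμφ := hA.μφ_pos
  have h2 : (μf - √nc * normC C * ‖ws‖) * ‖a‖ ^ 2 + μφ * ‖b‖ ^ 2 ≤ 0 := by linarith
  have p1 : 0 ≤ (μf - √nc * normC C * ‖ws‖) * ‖a‖ ^ 2 :=
    mul_nonneg (by linarith) (by positivity)
  have p2 : 0 ≤ μφ * ‖b‖ ^ 2 := by positivity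
  have ha0 : a = 0 := by
    have : (μf - √nc * normC C * ‖ws‖) * ‖a‖ ^ 2 = 0 := by linarith
    rcases mul_eq_zero.1 this with h | h
    · linarith
    · simpa using h
  have hb0 : b = 0 := by
    have : μφ * ‖b‖ ^ 2 = 0 := by linarith
    rcases mul_eq_zero.1 this with h | h
    · linarith
    · simpa using h
  subst ha0 hb0
  have h3 := key (0, rightInv P.Q c, 0)
  rw [show slackMap P (rightInv P.Q c) = c from apply_rightInv hA.Q_rank c] at h3
  have hc0 : c = 0 := by simpa using h3
  rw [hc0]
  rfl

/-- The Taylor expansion of the constraint is exact at second order, so on the feasible set the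
first-order terms reduce to the curvature term, which `μf / 2 * ‖x - xs‖ ^ 2` dominates. The minimum
obtained is even global. -/
lemma isLocalSolution_of_kkt (hA : Assumptions P μf Lf μφ Lφ ρ xf zφ)
    {xs : BlockVec ν} {zs : Vec nz} {ws : Vec nc} (hxs : xs ∈ feasSet P)
    (hr : residual P C xs zs = 0)
    (hx : ∀ a, fderiv ℝ P.f xs a + inner ℝ ws (jac P C xs a) = 0)
    (hz : DualConsistent P zs ws) (hsmall : √nc * normC C * ‖ws‖ ≤ μf) :
    IsLocalSolution P C xs zs := by
  refine ⟨hr, IsMinOn.localize ?_⟩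
  rintro ⟨x, z⟩ (hxz : residual P C x z = 0)
  change objF P xs + (P.φ zs : EReal) ≤ objF P x + (P.φ z : EReal)
  by_cases hxm : x ∈ feasSet P
  swap
  · rw [objF_of_notMem hxm, EReal.top_add_coe]
    exact le_top
  rw [objF_of_mem hxs, objF_of_mem hxm, ← EReal.coe_add, ← EReal.coe_add, EReal.coe_le_coe_iff]
  have h1 := strongConvex_lower hA.f_strong (hA.f_C2.differentiable (by norm_num)) xs x
  have h2 := strongConvex_lower hA.φ_strong (hA.φ_C2.differentiable (by norm_num)) zs z
  have h3 := hx (x - xs)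
  have h4 := dualConsistent_iff.1 hz (z - zs)
  have h5 : jac P C xs (x - xs) + slackMap P (z - zs) =
      -((1 / 2 : ℝ) • bilin C (x - xs) (x - xs)) := by
    have e1 := constraintMap_add P C xs (x - xs)
    rw [add_sub_cancel] at e1
    rw [residual_eq] at hr hxz
    rw [map_sub (slackMap P), eq_neg_iff_add_eq_zero]
    have e2 : constraintMap P C x + slackMap P z - (constraintMap P C xs + slackMap P zs) = 0 := by
      rw [hr, hxz, sub_zero]
    rw [e1] at e2
    rw [← e2]
    abel
  have h6 : inner ℝ ws (jac P C xs (x - xs)) + inner ℝ ws (slackMap P (z - zs)) =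
      -(1 / 2 * inner ℝ ws (bilin C (x - xs) (x - xs))) := by
    rw [← inner_add_right, h5, inner_neg_right, inner_smul_right]
  have h7 := (abs_le.1 (abs_inner_bilin_le (C := C) ws (x - xs))).1
  have h8 := mul_le_mul_of_nonneg_right hsmall (sq_nonneg ‖x - xs‖)
  have p2 : 0 ≤ μφ / 2 * ‖z - zs‖ ^ 2 := by have := hA.μφ_pos; positivity
  linarith

/-- The conclusions hold as soon as the multipliers of the limit points are small compared with
`μ_f / (√n_c ‖C‖)`; `B` is an upper bound for the Lagrangian after one iteration. -/
theorem IsADMM.linearConvergence (hA : Assumptions P μf Lf μφ Lφ ρ xf zφ) (hC : IsMultiAffine P C)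
    (hI : IsADMM P C ρ x z w) (hnc : 0 < nc) (hx : x 0 ∈ feasSet P) {B : ℝ}
    (hB : lagR P C ρ (x 1, z 1, w 1) ≤ B)
    (hsmall : √nc * normC C * (‖(P.Q * P.Qᵀ)⁻¹ * P.Q‖ *
      (Lφ * √(2 * (B - P.f xf - P.φ zφ) / μφ))) < μf) :
    LinearConvergence P C ρ x z w := by
  refine ⟨hI.exists_mapClusterPt hA hC hnc hx, fun xs zs ws hps hT => ?_⟩
  set ps : BlockVec ν × Vec nz × Vec nc := (xs, zs, ws) with hpsdef
  have hps' : MapClusterPt ps atTop (iterates x z w) := hps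
  have hsm := contDiff_lagR hA.f_C2 hA.φ_C2 C ρ
  have hd : Differentiable ℝ (lagR P C ρ) := hsm.differentiable (by norm_num)
  have hsm1 : ContDiff ℝ 1 (fderiv ℝ (lagR P C ρ)) := hsm.fderiv_right (by norm_num)
  -- Twice differentiability includes finiteness nearby, so `xs` is interior to the product of the
  -- `X i`.
  have hfeas' : ∀ᶠ q in 𝓝 ps, q.1 ∈ feasSet P := by
    filter_upwards [hT.1] with q hq
    by_contra hcon
    exact hq.1 (lagrangian_of_notMem hcon)
  obtain ⟨K, t, ht, hLip⟩ := hsm1.contDiffAt (x := ps) |>.exists_lipschitzOnWith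
  obtain ⟨ε, hε, hball⟩ := Metric.eventually_nhds_iff_ball.1 (hfeas'.and ht)
  have hfeas : ∀ q ∈ Metric.ball ps ε, q.1 ∈ feasSet P := fun q hq => (hball q hq).1
  have hK : ∀ q ∈ Metric.ball ps ε, ∀ q' ∈ Metric.ball ps ε,
      ‖fderiv ℝ (lagR P C ρ) q - fderiv ℝ (lagR P C ρ) q'‖ ≤ K * ‖q - q'‖ := fun q hq q' hq' =>
    hLip.norm_sub_le (hball q hq).2 (hball q' hq').2
  have hgrad := fun k hk hk1 => hI.norm_fderiv_le hA K.2 hfeas hK (k := k) hk hk1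
  have hstep := hI.tendsto_step hA hC hnc hx
  have hstat := fderiv_eq_zero_of_mapClusterPt hA (by positivity) hps' hstep hgrad
  obtain ⟨hr, hkx, hkz⟩ := kkt_of_stationary hA hstat
  have hdesc := fun k (hk : k ≥ 1) => hI.step_sq_le hA hC hnc (hI.mem_feasSet hA hC hx k)
      (hI.dualConsistent_of_one_le hA hC hx hk)
  have hanti := fun k (hk : k ≥ 1) => hI.lagR_succ_le hA hC hnc (hI.mem_feasSet hA hC hx k)
      (hI.dualConsistent_of_one_le hA hC hx hk)
  have hmin := fun k (hk : k ≥ 1) => min_le_lagR (C := C) hA hnc (x k)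
    (hI.dualConsistent_of_one_le hA hC hx hk)
  have hval : P.f xs + P.φ zs ≤ B := by
    obtain ⟨ψ, hψ, hlim⟩ := hps'.tendsto_subseq
    have h1 : Tendsto (fun j => lagR P C ρ (iterates x z w (ψ j))) atTop (𝓝 (lagR P C ρ ps)) :=
      (hsm.continuous.tendsto ps).comp hlim
    have h2 : lagR P C ρ ps ≤ B := by
      refine le_of_tendsto h1 ?_
      filter_upwards [hψ.tendsto_atTop.eventually_ge_atTop 1] with j hj
      exact (hI.lagR_le_one hA hC hnc hx hj).trans hB
    simpa [lagR, hpsdef, hr] using h2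
  -- The residual vanishes at the limit, so `hval` and the quadratic growth of `φ` bound `‖zs -
  -- zφ‖`, and consistency bounds `ws`.
  have hws : √nc * normC C * ‖ws‖ < μf := by
    refine lt_of_le_of_lt ?_ hsmall
    refine mul_le_mul_of_nonneg_left ?_ (mul_nonneg (Real.sqrt_nonneg _) (normC_nonneg C))
    refine (norm_dual_le hA hkz).trans ?_
    have hL := hA.φ_smooth.1
    gcongr
    refine Real.le_sqrt_of_sq_le ?_
    rw [le_div_iff₀ hA.μφ_pos]
    have h1 := φ_growth hA zs
    have h2 : P.f xf ≤ P.f xs := hA.f_min (Set.mem_univ xs)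
    linarith
  have hnd := hessian_lagR_nondegenerate (ρ := ρ) hA hr hws
  obtain ⟨c₁, hc₁, hev⟩ := exists_error_bound (hsm1.differentiable (by norm_num) ps) hstat hnd
  obtain ⟨ε₂, hε₂, herr⟩ := Metric.eventually_nhds_iff_ball.1 hev
  have hρ := hA.ρ_pos
  have hμf := hA.μf_pos
  have hμφ := hA.μφ_pos
  obtain ⟨hconv, hrate⟩ := linear_convergence_of_error_bound (p := iterates x z w)
    (g := lagR P C ρ) (ps := ps) (c := 2 / μf + 4 / μφ + ρ)
    (c₁ := c₁ * ((n + 1) * K + ρ⁻¹)) (C := K) (ε := min (ε / 3) ε₂) (by positivity) hdesc hanti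
    hmin hps' hsm.continuous.continuousAt (by positivity) (by positivity)
    (fun k hk hk1 => by
      have h1 := herr _ (Metric.ball_subset_ball (min_le_right _ _) hk1)
      have h2 := hgrad k (Metric.ball_subset_ball (min_le_left _ _) hk)
        (Metric.ball_subset_ball (min_le_left _ _) hk1)
      calc _ ≤ _ := h1
        _ ≤ c₁ * (((n + 1) * K + ρ⁻¹) * ‖iterates x z w (k + 1) - iterates x z w k‖) :=
          mul_le_mul_of_nonneg_left h2 hc₁.le
        _ = _ := by ring) K.2
    (fun q hq => by
      have hsub : Metric.ball ps (min (ε / 3) ε₂) ⊆ Metric.ball ps ε :=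
        Metric.ball_subset_ball ((min_le_left _ _).trans (by linarith))
      exact quadratic_upper hd hstat K.2
        (fun q hq => hK q hq ps (Metric.mem_ball_self hε)) (hsub hq))
  have heq := lagrangian_toReal_eventuallyEq (C := C) (ρ := ρ) hε hfeas
  have hpsfeas : ps.1 ∈ feasSet P := hfeas ps (Metric.mem_ball_self hε)
  have hlag : ∀ k, lagrangian P C ρ (x k, z k, w k) = (lagR P C ρ (iterates x z w k) : EReal) :=
    fun k => lagrangian_of_mem (hI.mem_feasSet hA hC hx k)
  refine ⟨fun u hu => hnd u fun v => ?_, hconv, fun k => ?_, ?_,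
    isLocalSolution_of_kkt hA hpsfeas hr hkx hkz hws.le⟩
  · rw [← heq.fderiv.fderiv_eq]
    exact hu v
  · rw [hlag k]
    exact ⟨EReal.coe_ne_top _, EReal.coe_ne_bot _⟩
  · obtain ⟨r, hr1, hO⟩ := hrate
    refine ⟨r, hr1, ?_⟩
    simp only [hlag, lagrangian_of_mem hpsfeas, EReal.toReal_coe]
    exact hO

end LimitPoints

/-! ### Explicit and implicit thresholds on the quadratic part -/

section Thresholds

variable {n : ℕ} {ν : Fin n → ℕ} {nc nz : ℕ} {P : Data n ν nc nz} {C : QuadPart ν nc}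
  {μf Lf μφ Lφ ρ : ℝ} {xf : BlockVec ν} {zφ : Vec nz}
  {x : ℕ → BlockVec ν} {z : ℕ → Vec nz} {w : ℕ → Vec nc}

/-- Clearing the denominator covers the convention that the quotient is infinite when `D = 0`. -/
lemma mul_le_of_ofReal_le_mul_div {c a N D : ℝ} (ha : 0 ≤ a) (hN : 0 ≤ N) (hc : 0 ≤ c)
    (h : ENNReal.ofReal c ≤ ENNReal.ofReal a * (ENNReal.ofReal N / ENNReal.ofReal D)) :
    c * D ≤ a * N := by
  have h1 : ENNReal.ofReal c * ENNReal.ofReal D ≤ ENNReal.ofReal a * ENNReal.ofReal N := by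
    refine (mul_le_mul_left h _).trans ?_
    rw [mul_assoc]
    gcongr
    rw [mul_comm]
    exact ENNReal.mul_div_le
  rw [← ENNReal.ofReal_mul hc, ← ENNReal.ofReal_mul ha] at h1
  exact (ENNReal.ofReal_le_ofReal_iff (by positivity)).1 h1

lemma sqrt_cube_mul_sq {L m : ℝ} (hL : 0 ≤ L) (hm : 0 ≤ m) : √(L ^ 3 * m ^ 2) = L * √L * m := by
  have : L ^ 3 * m ^ 2 = (L * m) ^ 2 * L := by ring
  rw [this, Real.sqrt_mul (by positivity), Real.sqrt_sq (by positivity)]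
  ring

lemma QCondition.bounds {κ : ℝ} (hκ : 0 ≤ κ) (hA : Assumptions P μf Lf μφ Lφ ρ xf zφ)
    (hnc : 0 < nc) {x0 : BlockVec ν} (h : QCondition κ P C μf Lf μφ Lφ xf zφ x0) :
    let G := ‖(P.Q * P.Qᵀ)⁻¹ * P.Q‖
    let l := lamMin (P.Q * P.Qᵀ)
    normC C * (√nc * Lφ * (√Lf * (‖xf‖ + ‖x0‖) + √Lφ * ‖zφ‖)) ≤ κ * G⁻¹ * (μf * √μφ) ∧
    normC C * (Lφ * √Lφ * nc * (‖x0‖ * normd P + norme P)) ≤ κ * G⁻¹ * √l * (μf * √μφ) ∧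
    normC C ^ 2 * (Lφ * √Lφ * nc * ‖x0‖ ^ 2) ≤ κ ^ 2 * G⁻¹ ^ 2 * (√l * G) * (μf * √μφ) := by
  intro G l
  have hl : 0 < l := lamMin_pos hA.Q_rank hnc
  have hG : 0 ≤ G := norm_nonneg _
  have hμf := hA.μf_pos
  have hμφ := hA.μφ_pos
  have hLφ := hA.φ_smooth.1
  have hC0 := normC_nonneg C
  have hsq := sqrt_cube_mul_sq hLφ.le (Nat.cast_nonneg (α := ℝ) nc)
  unfold QCondition at h
  have h1 := h.trans (mul_le_mul_right (min_le_left _ _) _)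
  have h2 := h.trans (mul_le_mul_right ((min_le_right _ _).trans (min_le_left _ _)) _)
  have h3 := h.trans (mul_le_mul_right ((min_le_right _ _).trans (min_le_right _ _)) _)
  refine ⟨mul_le_of_ofReal_le_mul_div (by positivity) (by positivity) hC0 h1, ?_, ?_⟩
  · rw [m₂, mul_comm (_ / _), ← mul_assoc, ← ENNReal.ofReal_mul (by positivity),
      ← Real.sqrt_eq_rpow, hsq] at h2
    exact mul_le_of_ofReal_le_mul_div (by positivity) (by positivity) hC0 h2
  · rw [m₃, mul_comm (_ ^ _), ← mul_assoc, ← ENNReal.ofReal_mul (by positivity), hsq] at h3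
    -- Squaring removes the root in `m₃` and turns the quarter power of `l` into `√l`.
    have h4 := pow_le_pow_left' h3 2
    rw [mul_pow, ← ENNReal.ofReal_pow hC0, ← ENNReal.ofReal_pow (by positivity),
      ← ENNReal.rpow_mul_natCast] at h4
    norm_num at h4
    have h5 := mul_le_of_ofReal_le_mul_div (by positivity) (by positivity) (by positivity) h4
    refine h5.trans_eq ?_
    have e1 : (l ^ (1 / 4 : ℝ)) ^ 2 = √l := by
      rw [← Real.rpow_mul_natCast hl.le, Real.sqrt_eq_rpow]; norm_num
    have e2 : (G ^ (1 / 2 : ℝ)) ^ 2 = G := by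
      rw [← Real.sqrt_eq_rpow, Real.sq_sqrt hG]
    calc _ = κ ^ 2 * G⁻¹ ^ 2 * ((l ^ (1 / 4 : ℝ)) ^ 2 * (G ^ (1 / 2 : ℝ)) ^ 2) * (μf * √μφ) := by
          ring
      _ = _ := by rw [e1, e2]

/-- Feasibility and consistency make `z0` a minimiser of `φ` among the slacks feasible for `x0`.
Comparing it with the minimum norm slack `z1` removes `z0` from the bound, and smoothness at the two
unconstrained minimisers does the rest. -/
lemma initial_gap_le (hA : Assumptions P μf Lf μφ Lφ ρ xf zφ) (hnc : 0 < nc)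
    {x0 : BlockVec ν} {z0 : Vec nz} {w0 : Vec nc} (hr : residual P C x0 z0 = 0)
    (hz : DualConsistent P z0 w0) :
    √(2 * (P.f x0 + P.φ z0 - P.f xf - P.φ zφ) / μφ) ≤
      (√Lf * (‖xf‖ + ‖x0‖) + √Lφ * (‖zφ‖ + √nc *
        (normC C * ‖x0‖ ^ 2 / 2 + normd P * ‖x0‖ + norme P) / √(lamMin (P.Q * P.Qᵀ)))) / √μφ := by
  set l := lamMin (P.Q * P.Qᵀ)
  set α := √nc * (normC C * ‖x0‖ ^ 2 / 2 + normd P * ‖x0‖ + norme P) with hα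
  have hl : 0 < l := lamMin_pos hA.Q_rank hnc
  have hμφ := hA.μφ_pos
  have hLφ := hA.φ_smooth.1
  have hLf := hA.f_smooth.1
  have hα0 : ‖constraintMap P C x0‖ ≤ α := norm_constraintMap_le P C x0
  have hα1 : 0 ≤ α := (norm_nonneg _).trans hα0
  have hf := smooth_upper (hA.f_C2.differentiable (by norm_num))
    (fun u v => hA.f_smooth.fderiv_lipschitz u v) xf x0
  rw [fderiv_eq_zero_of_isMinOn hA.f_min, zero_apply, add_zero] at hf
  set z1 := -rightInv P.Q (constraintMap P C x0) with hz1
  have hφ := smooth_upper (hA.φ_C2.differentiable (by norm_num))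
    (fun u v => hA.φ_smooth.fderiv_lipschitz u v) zφ z1
  rw [fderiv_eq_zero_of_isMinOn hA.φ_min, zero_apply, add_zero] at hφ
  have hQ : slackMap P (z1 - z0) = 0 := by
    have e1 : slackMap P (rightInv P.Q (constraintMap P C x0)) = constraintMap P C x0 :=
      apply_rightInv hA.Q_rank _
    rw [residual_eq] at hr
    rw [map_sub, hz1, map_neg, e1, ← neg_add', hr, neg_zero]
  have h1 := dualConsistent_iff.1 hz (z1 - z0)
  rw [hQ, inner_zero_right, add_zero] at h1
  have h2 := strongConvex_lower hA.φ_strong (hA.φ_C2.differentiable (by norm_num)) z0 z1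
  rw [h1] at h2
  have p1 : 0 ≤ μφ / 2 * ‖z1 - z0‖ ^ 2 := by positivity
  have h3 := norm_rightInv_sq_le hA.Q_rank hnc (constraintMap P C x0)
  have h4 : ‖rightInv P.Q (constraintMap P C x0)‖ ≤ α / √l := by
    rw [le_div_iff₀ (Real.sqrt_pos.2 hl), ← sq_le_sq₀ (by positivity) hα1, mul_pow,
      Real.sq_sqrt hl.le]
    have : ‖constraintMap P C x0‖ ^ 2 ≤ α ^ 2 := by gcongr
    linarith
  have h5 : ‖z1 - zφ‖ ≤ ‖zφ‖ + α / √l := by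
    have := norm_sub_le z1 zφ
    rw [hz1, norm_neg] at this
    rw [hz1]
    linarith
  have h6 : ‖x0 - xf‖ ≤ ‖xf‖ + ‖x0‖ := (norm_sub_le _ _).trans_eq (add_comm _ _)
  refine Real.sqrt_le_iff.2 ⟨by positivity, ?_⟩
  rw [div_pow, Real.sq_sqrt hμφ.le]
  refine div_le_div_of_nonneg_right ?_ hμφ.le
  set a := ‖xf‖ + ‖x0‖
  set b := ‖zφ‖ + α / √l
  have ha : 0 ≤ a := by positivity
  have hb : 0 ≤ b := by positivity
  have e1 : Lf * ‖x0 - xf‖ ^ 2 ≤ (√Lf * a) ^ 2 := by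
    rw [mul_pow, Real.sq_sqrt hLf.le]; gcongr
  have e2 : Lφ * ‖z1 - zφ‖ ^ 2 ≤ (√Lφ * b) ^ 2 := by
    rw [mul_pow, Real.sq_sqrt hLφ.le]; gcongr
  have e3 : 0 ≤ √Lf * a * (√Lφ * b) := by positivity
  nlinarith

lemma IsADMM.linearConvergence_of_QCondition (hA : Assumptions P μf Lf μφ Lφ ρ xf zφ)
    (hC : IsMultiAffine P C) (hI : IsADMM P C ρ x z w) (hnc : 0 < nc) (hx : x 0 ∈ feasSet P)
    (hr : residual P C (x 0) (z 0) = 0) (hz : DualConsistent P (z 0) (w 0))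
    (hQ : QCondition (1 / 4) P C μf Lf μφ Lφ xf zφ (x 0)) : LinearConvergence P C ρ x z w := by
  have hB : lagR P C ρ (x 1, z 1, w 1) ≤ P.f (x 0) + P.φ (z 0) := by
    refine (hI.lagR_succ_le hA hC hnc hx hz).trans_eq ?_
    simp [lagR, hr]
  refine hI.linearConvergence hA hC hnc hx hB ?_
  obtain ⟨b1, b2, b3⟩ := hQ.bounds (by norm_num) hA hnc
  have hgap := initial_gap_le hA hnc hr hz
  set S := √(2 * (P.f (x 0) + P.φ (z 0) - P.f xf - P.φ zφ) / μφ)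
  set G := ‖(P.Q * P.Qᵀ)⁻¹ * P.Q‖
  set l := lamMin (P.Q * P.Qᵀ)
  set c := normC C
  set T₁ := √Lf * (‖xf‖ + ‖x 0‖) + √Lφ * ‖zφ‖ with hT₁
  have hl : 0 < √l := Real.sqrt_pos.2 (lamMin_pos hA.Q_rank hnc)
  have hG : 0 ≤ G := norm_nonneg _
  have hc : 0 ≤ c := normC_nonneg C
  have hμf := hA.μf_pos
  have hμφ : 0 < √μφ := Real.sqrt_pos.2 hA.μφ_pos
  have hLφ := hA.φ_smooth.1
  have hn : √(nc : ℝ) * √nc = nc := Real.mul_self_sqrt (Nat.cast_nonneg _)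
  have hGG : G * G⁻¹ ≤ 1 := mul_inv_le_one
  have hGG0 : 0 ≤ G * G⁻¹ := by positivity
  have t1 : G * (c * (√nc * Lφ * T₁)) / √μφ ≤ 1 / 4 * μf := by
    rw [div_le_iff₀ hμφ]
    calc _ ≤ G * (1 / 4 * G⁻¹ * (μf * √μφ)) := by gcongr
      _ = G * G⁻¹ * (1 / 4 * μf * √μφ) := by ring
      _ ≤ 1 * (1 / 4 * μf * √μφ) := by gcongr
      _ = _ := by ring
  have t2 : G * (c * (Lφ * √Lφ * nc * (‖x 0‖ * normd P + norme P))) / (√l * √μφ) ≤ 1 / 4 * μf := by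
    rw [div_le_iff₀ (by positivity)]
    calc _ ≤ G * (1 / 4 * G⁻¹ * √l * (μf * √μφ)) := by gcongr
      _ = G * G⁻¹ * (1 / 4 * μf * (√l * √μφ)) := by ring
      _ ≤ 1 * (1 / 4 * μf * (√l * √μφ)) := by gcongr
      _ = _ := by ring
  have t3 : G * (c ^ 2 * (Lφ * √Lφ * nc * ‖x 0‖ ^ 2)) / (√l * √μφ) ≤ 1 / 4 * μf := by
    rw [div_le_iff₀ (by positivity)]
    calc _ ≤ G * ((1 / 4) ^ 2 * G⁻¹ ^ 2 * (√l * G) * (μf * √μφ)) := by gcongr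
      _ = (G * G⁻¹) * (G * G⁻¹) * (1 / 16 * μf * (√l * √μφ)) := by ring
      _ ≤ 1 * 1 * (1 / 16 * μf * (√l * √μφ)) := by gcongr
      _ ≤ _ := by
        have : 0 ≤ μf * (√l * √μφ) := by positivity
        linarith
  calc √nc * c * (G * (Lφ * S))
      -- The bound splits into three terms, one for each of `m₁`, `m₂`, `m₃`. With `κ = 1 / 4` they
      -- are at most `1 / 4`, `1 / 4` and `1 / 8` of `μf`.
      ≤ √nc * c * (G * (Lφ * ((√Lf * (‖xf‖ + ‖x 0‖) + √Lφ * (‖zφ‖ + √nc *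
        (c * ‖x 0‖ ^ 2 / 2 + normd P * ‖x 0‖ + norme P) / √l)) / √μφ))) := by gcongr
    _ = G * (c * (√nc * Lφ * T₁)) / √μφ
        + G * (c * (Lφ * √Lφ * (√nc * √nc) * (‖x 0‖ * normd P + norme P))) / (√l * √μφ)
        + G * (c ^ 2 * (Lφ * √Lφ * (√nc * √nc) * ‖x 0‖ ^ 2)) / (√l * √μφ) / 2 := by
      rw [hT₁]; field_simp; ring
    _ < μf := by rw [hn]; linarith

/-- From an arbitrary start the first dual update may raise the Lagrangian. Its value after that
update is still bounded independently of `C` once `normC C ≤ 1`, and descent holds from then on. -/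
lemma exists_threshold (hA : Assumptions P μf Lf μφ Lφ ρ xf zφ) (hnc : 0 < nc)
    {x0 : BlockVec ν} (z0 : Vec nz) (w0 : Vec nc) (hx0 : x0 ∈ feasSet P) :
    ∃ δ : ℝ, 0 < δ ∧ ∀ C : QuadPart ν nc, IsMultiAffine P C → normC C ≤ δ →
      ∀ (x : ℕ → BlockVec ν) (z : ℕ → Vec nz) (w : ℕ → Vec nc), IsADMM P C ρ x z w →
        x 0 = x0 → z 0 = z0 → w 0 = w0 → LinearConvergence P C ρ x z w := by
  have hρ := hA.ρ_pos
  have hμf := hA.μf_pos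
  have hLφ := hA.φ_smooth.1
  set m := P.f xf + P.φ zφ with hm
  -- The factor `1` replaces `normC C`, so that `R`, `B₀` and `B` do not depend on `C`.
  set R := √nc * (1 * ‖x0‖ ^ 2 / 2 + normd P * ‖x0‖ + norme P) + ‖slackMap P z0‖ with hR
  set B₀ := P.f x0 + P.φ z0 + ‖w0‖ * R + ρ / 2 * R ^ 2 with hB₀
  -- The second summand bounds `ρ * ‖r‖ ^ 2`, the increase caused by the first dual update: half of
  -- the penalty absorbs the inner product with `w0`, leaving `ρ / 4 * ‖r‖ ^ 2`.
  set B := B₀ + 4 * (B₀ - m + ‖w0‖ ^ 2 / ρ) with hB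
  set S := ‖(P.Q * P.Qᵀ)⁻¹ * P.Q‖ * (Lφ * √(2 * (B - P.f xf - P.φ zφ) / μφ)) with hS
  have hS0 : 0 ≤ S := by positivity
  -- The factor `2` makes the final inequality strict; the `1` in the denominator covers `S = 0`.
  refine ⟨min 1 (μf / (2 * (√nc * S + 1))), by positivity, ?_⟩
  intro C hC hCδ x z w hI hx hz hw
  have hC1 : normC C ≤ 1 := hCδ.trans (min_le_left _ _)
  have hC2 : normC C ≤ μf / (2 * (√nc * S + 1)) := hCδ.trans (min_le_right _ _)
  have hC0 := normC_nonneg C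
  subst hx hz hw
  have hr0 : ‖residual P C (x 0) (z 0)‖ ≤ R := by
    rw [residual_eq]
    refine (norm_add_le _ _).trans (add_le_add_left ((norm_constraintMap_le P C (x 0)).trans ?_) _)
    gcongr
  have hL0 : lagR P C ρ (x 0, z 0, w 0) ≤ B₀ := by
    have h1 := (real_inner_le_norm (w 0) (residual P C (x 0) (z 0))).trans
      (mul_le_mul_of_nonneg_left hr0 (norm_nonneg _))
    have h2 : ρ / 2 * ‖residual P C (x 0) (z 0)‖ ^ 2 ≤ ρ / 2 * R ^ 2 := by gcongr
    simp only [lagR]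
    linarith
  have hx1 := hI.x_descent hA hC hx0
  have hz1 := hI.z_descent hA hx1.1
  have hL1 : lagR P C ρ (x 1, z 1, w 1) ≤ B := by
    have hw1 := hI.w_step 0
    simp only [zero_add] at hx1 hz1 hw1
    rw [hw1, lagR_add_smul_residual]
    set r := residual P C (x 1) (z 1) with hr
    have p1 : 0 ≤ μf / 2 * ‖x 1 - x 0‖ ^ 2 := by positivity
    have p2 : 0 ≤ μφ / 2 * ‖z 1 - z 0‖ ^ 2 := by have := hA.μφ_pos; positivity
    have hle : lagR P C ρ (x 1, z 1, w 0) ≤ B₀ := by linarith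
    have hle2 := hle
    simp only [lagR, ← hr] at hle2
    have hf : P.f xf ≤ P.f (x 1) := hA.f_min (Set.mem_univ _)
    have hφ : P.φ zφ ≤ P.φ (z 1) := hA.φ_min (Set.mem_univ _)
    have hin := (abs_le.1 (abs_real_inner_le_norm (w 0) r)).1
    have hamgm : ‖w 0‖ * ‖r‖ ≤ ρ / 4 * ‖r‖ ^ 2 + ‖w 0‖ ^ 2 / ρ := by
      have e : ρ / 4 * ‖r‖ ^ 2 + ‖w 0‖ ^ 2 / ρ - ‖w 0‖ * ‖r‖ =
          (ρ / 2 * ‖r‖ - ‖w 0‖) ^ 2 / ρ := by field_simp; ring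
      have : 0 ≤ (ρ / 2 * ‖r‖ - ‖w 0‖) ^ 2 / ρ := by positivity
      linarith
    linarith
  refine hI.linearConvergence hA hC hnc hx0 hL1 ?_
  rw [← hS]
  rw [le_div_iff₀ (by positivity)] at hC2
  have : √nc * normC C * S = normC C * (√nc * S) := by ring
  rw [this]
  nlinarith

end Thresholds

end MultiAffineADMM

theorem mainTheorem2 :
    -- absolute constant, explicit `m₁, m₂, m₃`, feasible and dual-consistent starting point
    (∃ κ : ℝ, 0 < κ ∧
      ∀ (n : ℕ) (ν : Fin n → ℕ) (nc nz : ℕ), 0 < nc →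
      ∀ (P : MultiAffineADMM.Data n ν nc nz) (C : MultiAffineADMM.QuadPart ν nc)
        (μf Lf μφ Lφ ρ : ℝ) (xf : MultiAffineADMM.BlockVec ν) (zφ : MultiAffineADMM.Vec nz),
        MultiAffineADMM.Assumptions P μf Lf μφ Lφ ρ xf zφ →
        MultiAffineADMM.IsMultiAffine P C →
      ∀ (x : ℕ → MultiAffineADMM.BlockVec ν) (z : ℕ → MultiAffineADMM.Vec nz)
        (w : ℕ → MultiAffineADMM.Vec nc),
        MultiAffineADMM.IsADMM P C ρ x z w →
        (∀ i, x 0 i ∈ P.X i) →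
        MultiAffineADMM.residual P C (x 0) (z 0) = 0 →
        Matrix.toEuclideanLin P.Qᵀ (w 0) = -gradient P.φ (z 0) →
        MultiAffineADMM.QCondition κ P C μf Lf μφ Lφ xf zφ (x 0) →
        MultiAffineADMM.LinearConvergence P C ρ x z w) ∧
    -- arbitrary dual and slack starting values, with a threshold that may depend on them
    (∀ (n : ℕ) (ν : Fin n → ℕ) (nc nz : ℕ), 0 < nc →
      ∀ (P : MultiAffineADMM.Data n ν nc nz)
        (μf Lf μφ Lφ ρ : ℝ) (xf : MultiAffineADMM.BlockVec ν) (zφ : MultiAffineADMM.Vec nz),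
        MultiAffineADMM.Assumptions P μf Lf μφ Lφ ρ xf zφ →
      ∀ (x0 : MultiAffineADMM.BlockVec ν) (z0 : MultiAffineADMM.Vec nz)
        (w0 : MultiAffineADMM.Vec nc), (∀ i, x0 i ∈ P.X i) →
      ∃ δ : ℝ, 0 < δ ∧
      ∀ C : MultiAffineADMM.QuadPart ν nc,
        MultiAffineADMM.IsMultiAffine P C → MultiAffineADMM.normC C ≤ δ →
      ∀ (x : ℕ → MultiAffineADMM.BlockVec ν) (z : ℕ → MultiAffineADMM.Vec nz)
        (w : ℕ → MultiAffineADMM.Vec nc),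
        MultiAffineADMM.IsADMM P C ρ x z w →
        x 0 = x0 → z 0 = z0 → w 0 = w0 →
        MultiAffineADMM.LinearConvergence P C ρ x z w) := by
  refine ⟨⟨1 / 4, by norm_num, ?_⟩, ?_⟩
  · intro n ν nc nz hnc P C μf Lf μφ Lφ ρ xf zφ hA hC x z w hI hx hr hz hQ
    exact hI.linearConvergence_of_QCondition hA hC hnc hx hr hz hQ
  · intro n ν nc nz hnc P μf Lf μφ Lφ ρ xf zφ hA x0 z0 w0 hx0
    exact MultiAffineADMM.exists_threshold hA hnc z0 w0 hx0
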